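/- Let $1\le k$ and $n$ be integers, let $R>0$, and write $B_r$ for the open ball of radius $r$ about $0$ in $\mathbb R^n$ and $\mathcal H^m$ for $m$-dimensional Hausdorff measure. Let $(N^i)_{i\in\mathbb N}$ be a sequence of smooth embedded $k$-dimensional submanifolds of $\mathbb R^n$, possibly with boundary $\partial N^i$, and let $\alpha_i$ be smooth real functions on $N^i$, with $\nabla\alpha_i$ the gradient on $N^i$ for the metric induced from $\mathbb R^n$. Assume: a) There is a constant $D_0$ such that, for all $i\in\mathbb N$, $$\mathcal H^k(N^i\cap B_{3R})\le D_0R^k,$$ and $$\bigl(\mathcal H^k(A)\bigr)^{(k-1)/k}\le D_0\,\mathcal H^{k-1}(\partial A)$$ for every nonempty (relatively) open subset $A$ of $N^i\cap B_{3R}$ whose boundary $\partial A$ (the topological boundary of $A$ in $N^i$) is countably $(k-1)$-rectifiable, i.e. is covered, up to an $\mathcal H^{k-1}$-null set, by countably many Lipschitz images of $\mathbb R^{k-1}$. (For $k=1$ the left-hand side is $1$.) b) There is a constant $D_1$ such that, for all $i\in\mathbb N$, $$\sup_{N^i\cap B_{3R}}|\nabla\alpha_i|+R^{-1}\sup_{N^i\cap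 B_{3R}}|\alpha_i|\le D_1.$$ c) $$\lim_{i\to\infty}\int_{N^i\cap B_{3R}}|\nabla\alpha_i|^2\,d\mathcal H^k=0.$$ d) For all $i\in\mathbb N$, $\partial N^i\cap B_{3R}=\emptyset$, and at most one connected component of $N^i\cap B_{2R}$ intersects $B_R$. Then there are a real constant $\alpha$ and a subsequence $(i_j)_{j\in\mathbb N}$ such that $$\lim_{j\to\infty}\ \sup_{N^{i_j}\cap B_R}|\alpha_{i_j}-\alpha|=0$$ (the supremum over the empty set being $0$). -/

import Mathlib

open MeasureTheory Filter Topology Metric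
open scoped ENNReal NNReal ContDiff MeasureTheory

noncomputable section

namespace PoincareLemma

/-- The Euclidean space `ℝⁿ`. -/
abbrev Euc (n : ℕ) : Type := EuclideanSpace ℝ (Fin n)

/-- `Φ` is a smooth diffeomorphism between two open subsets of `ℝⁿ`. -/
def IsSmoothChart {n : ℕ} (Φ : OpenPartialHomeomorph (Euc n) (Euc n)) : Prop :=
  ContDiffOn ℝ ∞ Φ Φ.source ∧ ContDiffOn ℝ ∞ Φ.symm Φ.target

/-- Near `x`, in a smooth chart of `ℝⁿ`, the set `N` is a `k`-dimensional linear subspace. -/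
def IsInteriorPoint {n : ℕ} (k : ℕ) (N : Set (Euc n)) (x : Euc n) : Prop :=
  ∃ (Φ : OpenPartialHomeomorph (Euc n) (Euc n)) (V : Submodule ℝ (Euc n)),
    IsSmoothChart Φ ∧ Module.finrank ℝ V = k ∧ x ∈ Φ.source ∧ x ∈ N ∧
      ∀ y ∈ Φ.source, (y ∈ N ↔ Φ y ∈ V)

/-- Near `x`, in a smooth chart of `ℝⁿ`, the set `N` is a closed half space `{ℓ ≥ 0}` of a
`k`-dimensional linear subspace, and `x` corresponds to a point of the hyperplane `{ℓ = 0}`. -/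
def IsBoundaryPoint {n : ℕ} (k : ℕ) (N : Set (Euc n)) (x : Euc n) : Prop :=
  ∃ (Φ : OpenPartialHomeomorph (Euc n) (Euc n)) (V : Submodule ℝ (Euc n))
    (ℓ : Euc n →L[ℝ] ℝ),
    IsSmoothChart Φ ∧ Module.finrank ℝ V = k ∧ (∃ v ∈ V, ℓ v ≠ 0) ∧
      x ∈ Φ.source ∧ x ∈ N ∧ ℓ (Φ x) = 0 ∧
      ∀ y ∈ Φ.source, (y ∈ N ↔ Φ y ∈ V ∧ 0 ≤ ℓ (Φ y))

/-- `N` is a smooth embedded `k`-dimensional submanifold of `ℝⁿ`, possibly with boundary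
(and not necessarily closed as a subset of `ℝⁿ`). -/
def IsSmoothSubmanifold {n : ℕ} (k : ℕ) (N : Set (Euc n)) : Prop :=
  ∀ x ∈ N, IsInteriorPoint k N x ∨ IsBoundaryPoint k N x

/-- The boundary `∂N` of a `k`-dimensional submanifold `N`. -/
def manifoldBoundary {n : ℕ} (k : ℕ) (N : Set (Euc n)) : Set (Euc n) :=
  {x | IsBoundaryPoint k N x}

/-- The tangent space `T_x N`, as a linear subspace of `ℝⁿ`. -/
def tangentSpaceAt {n : ℕ} (N : Set (Euc n)) (x : Euc n) : Submodule ℝ (Euc n) :=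
  Submodule.span ℝ (tangentConeAt ℝ N x)

/-- The differential `d(f|_N)_x : T_x N → ℝ`. The derivative of `f` within `N` is only
determined in the directions tangent to `N`, and only these are kept. -/
def tangentialDifferential {n : ℕ} (N : Set (Euc n)) (f : Euc n → ℝ) (x : Euc n) :
    tangentSpaceAt N x →L[ℝ] ℝ :=
  (fderivWithin ℝ f N x).comp (tangentSpaceAt N x).subtypeL

/-- The gradient `∇f(x) ∈ T_x N` of a function `f` on `N`, for the metric induced by `ℝⁿ`. -/
def tangentialGradient {n : ℕ} (N : Set (Euc n)) (f : Euc n → ℝ) (x : Euc n) :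
    tangentSpaceAt N x :=
  (InnerProductSpace.toDual ℝ (tangentSpaceAt N x)).symm (tangentialDifferential N f x)

/-- The topological boundary of `A` relative to `N`, for `A ⊆ N`. -/
def relBoundary {n : ℕ} (N A : Set (Euc n)) : Set (Euc n) :=
  N ∩ closure A ∩ closure (N \ A)

/-- `S` is countably `m`-rectifiable: up to a set of `m`-dimensional Hausdorff measure zero
it is covered by countably many Lipschitz images of `ℝᵐ`. -/
def IsCountablyRectifiable {n : ℕ} (m : ℕ) (S : Set (Euc n)) : Prop :=
  ∃ F : ℕ → Euc m → Euc n, (∀ j, ∃ K : ℝ≥0, LipschitzWith K (F j)) ∧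
    μH[(m : ℝ)] (S \ ⋃ j, Set.range (F j)) = 0

/-- The isoperimetric inequality `ℋᵏ(A)^((k-1)/k) ≤ D ℋᵏ⁻¹(∂A)` for all nonempty open
subsets `A` of `N ∩ U` whose boundary in `N` is rectifiable (`k ≥ 1`, `U` open). -/
def IsoperimetricInequality {n : ℕ} (k : ℕ) (D : ℝ) (N U : Set (Euc n)) : Prop :=
  ∀ A : Set (Euc n), A.Nonempty → A ⊆ N ∩ U → (∃ O : Set (Euc n), IsOpen O ∧ A = O ∩ (N ∩ U)) →
    IsCountablyRectifiable (k - 1) (relBoundary N A) →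
      μH[(k : ℝ)] A ^ (((k : ℝ) - 1) / k) ≤
        ENNReal.ofReal D * μH[((k - 1 : ℕ) : ℝ)] (relBoundary N A)

/-- The connected components of the set `S` that intersect `B`. -/
def componentsMeeting {n : ℕ} (S B : Set (Euc n)) : Set (Set (Euc n)) :=
  {C | (∃ x ∈ S, C = connectedComponentIn S x) ∧ (C ∩ B).Nonempty}

end PoincareLemma

end

/-! Suppose a function `f` of the sequence oscillates by more than `ε` on `B_R`. Cut a range of
length `ε` into `m` intervals of width `w`. By connectedness each interval has its middle value
attained at some `x` in `N ∩ B_{2R}`. The area bound and Cauchy–Schwarz make `∫ |∇f|` small, so the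
Eilenberg (coarea) inequality finds, on both sides of the middle value, levels `s < t` whose
`ℋᵏ⁻¹`-measure is at most a prescribed `η`.

Let `V(r)` be the measure of the band `{s < f < t}` inside `B_r(x)`. The isoperimetric inequality,
and the coarea inequality for the distance to `x`, give in integrated form `V^((k-1)/k) ≤ D₀ (V' +
2η)`. Once `V(ρ)` is bounded below, the `η` term is absorbed and `V(R/2) ≥ v` with `v` independent
of `w`. The `m` bands are disjoint, so `m v ≤ D₀ Rᵏ`, which is false if `m` was chosen large. The
bound on `V(ρ)` comes from the same growth argument applied to the sublevel sets of `variationDist`,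
which stay inside the band. Vanishing oscillation and compactness of a bounded interval then give
the constant.

The local Lipschitz constant `lipSlope` replaces the gradient: it is always measurable, is at most
`|∇f|`, and makes sense for distances and maxima. The argument rests on
`exists_measurable_level_bound`, `ae_isCountablyRectifiable_level`, `pow_le_measure_sublevel`,
`pow_le_measure_band` and `exists_forall_sub_le`. -/

namespace PoincareLemma

/-! ### Local Lipschitz constants. -/

section Slope

variable {X : Type*} [MetricSpace X]

/-- The local Lipschitz constant at `x` of the restriction of `u` to `N`. -/
noncomputable def lipSlope (N : Set X) (u : X → ℝ) (x : X) : ℝ≥0∞ :=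
  ⨅ (L : ℝ≥0) (_ : ∃ W ∈ 𝓝 x, LipschitzOnWith L u (N ∩ W)), (L : ℝ≥0∞)

theorem lipSlope_lt_iff {N : Set X} {u : X → ℝ} {x : X} {c : ℝ≥0∞} :
    lipSlope N u x < c ↔
      ∃ L : ℝ≥0, (L : ℝ≥0∞) < c ∧ ∃ W ∈ 𝓝 x, LipschitzOnWith L u (N ∩ W) := by
  simp only [lipSlope, iInf_lt_iff, exists_prop]
  exact exists_congr fun L => and_comm

theorem upperSemicontinuous_lipSlope (N : Set X) (u : X → ℝ) :
    UpperSemicontinuous (lipSlope N u) := by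
  intro x c hc
  obtain ⟨L, hL, W, hW, hu⟩ := lipSlope_lt_iff.1 hc
  filter_upwards [eventually_mem_nhds_iff.2 hW] with y hy
  exact lipSlope_lt_iff.2 ⟨L, hL, W, hy, hu⟩

end Slope

/-! ### The Eilenberg inequality, with constant one. -/

section Eilenberg

variable {X : Type*} [MetricSpace X] [MeasurableSpace X] [BorelSpace X]

/-- One scale of the Eilenberg inequality: a cover of `A` of small total `(d+1)`-content gives
covers of the level sets of `u` whose `d`-contents have a small integral. -/
theorem exists_measurable_level_content {u : X → ℝ} {L : ℝ≥0} {A : Set X}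
    (hu : LipschitzOnWith L u A) {d : ℝ} (hd : 0 ≤ d) {r c : ℝ≥0∞} (hr : 0 < r)
    (hc : μH[d + 1] A < c) :
    ∃ (G : ℝ → ℝ≥0∞) (t : ℕ → Set X), Measurable G ∧ ∫⁻ s, G s ≤ L * c ∧
      A ⊆ ⋃ j, t j ∧ (∀ j, ediam (t j) ≤ r) ∧
      ∀ s, ∑' i : {j // (t j ∩ (A ∩ u ⁻¹' {s})).Nonempty},
        ediam (t i ∩ (A ∩ u ⁻¹' {s})) ^ d ≤ G s := by
  rw [Measure.hausdorffMeasure_apply] at hc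
  have h1 := (le_iSup₂ (f := fun (r : ℝ≥0∞) (_ : 0 < r) => ⨅ (t : ℕ → Set X)
    (_ : A ⊆ ⋃ n, t n) (_ : ∀ n, ediam (t n) ≤ r),
      ∑' n, ⨆ _ : (t n).Nonempty, ediam (t n) ^ (d + 1)) r hr).trans_lt hc
  simp only [iInf_lt_iff] at h1
  obtain ⟨t, htA, htr, hsum⟩ := h1
  -- A piece `t j` meets only levels in `u(t j ∩ A)`, a set of length at most `L · diam (t j)`; the
  -- closure makes it measurable.
  set I : ℕ → Set ℝ := fun j => closure (u '' (t j ∩ A)) with hI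
  refine ⟨fun s => ∑' j, (I j).indicator (fun _ => ediam (t j) ^ d) s, t, ?_, ?_, htA, htr, ?_⟩
  · exact Measurable.tsum fun j =>
      measurable_const.indicator isClosed_closure.measurableSet
  · rw [lintegral_tsum fun j =>
      (measurable_const.indicator isClosed_closure.measurableSet).aemeasurable]
    calc ∑' j, ∫⁻ s, (I j).indicator (fun _ => ediam (t j) ^ d) s
        ≤ ∑' j, L * ⨆ _ : (t j).Nonempty, ediam (t j) ^ (d + 1) := by
          refine ENNReal.tsum_le_tsum fun j => ?_
          rw [lintegral_indicator_const isClosed_closure.measurableSet]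
          rcases (t j).eq_empty_or_nonempty with he | hne
          · simp [he]
          · simp only [hne, ciSup_unique]
            have h2 : volume (I j) ≤ L * ediam (t j) := by
              refine (Real.volume_le_diam _).trans ?_
              rw [hI, ediam_closure]
              refine ediam_le ?_
              rintro _ ⟨x, hx, rfl⟩ _ ⟨y, hy, rfl⟩
              refine (hu hx.2 hy.2).trans ?_
              gcongr
              exact edist_le_ediam_of_mem hx.1 hy.1
            calc ediam (t j) ^ d * volume (I j) ≤ ediam (t j) ^ d * (L * ediam (t j)) := by gcongr
              _ = L * (ediam (t j) ^ d * ediam (t j) ^ (1 : ℝ)) := by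
                  rw [ENNReal.rpow_one]; ring
              _ = L * ediam (t j) ^ (d + 1) := by
                  rw [← ENNReal.rpow_add_of_nonneg _ _ hd zero_le_one]
      _ = L * ∑' j, ⨆ _ : (t j).Nonempty, ediam (t j) ^ (d + 1) := ENNReal.tsum_mul_left
      _ ≤ L * c := by gcongr
  · intro s
    refine le_trans (ENNReal.tsum_le_tsum fun i => ?_)
      (ENNReal.tsum_comp_le_tsum_of_injective Subtype.val_injective
        fun j => (I j).indicator (fun _ => ediam (t j) ^ d) s)
    obtain ⟨j, x, hx⟩ := i
    have : s ∈ I j := subset_closure ⟨x, ⟨hx.1, hx.2.1⟩, hx.2.2⟩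
    rw [Set.indicator_of_mem this]
    exact ENNReal.rpow_le_rpow (ediam_mono Set.inter_subset_left) hd

/-- The Eilenberg inequality for Lipschitz functions. -/
theorem exists_measurable_level_bound_of_lipschitzOn {u : X → ℝ} {L : ℝ≥0} {A : Set X}
    (hu : LipschitzOnWith L u A) {d : ℝ} (hd : 0 ≤ d) (hA : μH[d + 1] A ≠ ⊤) :
    ∃ g : ℝ → ℝ≥0∞, Measurable g ∧ (∀ s, μH[d] (A ∩ u ⁻¹' {s}) ≤ g s) ∧
      ∫⁻ s, g s ≤ L * μH[d + 1] A := by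
  -- `r n` is both the mesh of the cover and the excess of its content; the value `⊤` at `n = 0` is
  -- harmless.
  set r : ℕ → ℝ≥0∞ := fun n => (n : ℝ≥0∞)⁻¹ with hr
  have hr0 : Tendsto r atTop (𝓝 0) := ENNReal.tendsto_inv_nat_nhds_zero
  have hrpos : ∀ n, 0 < r n := fun n => ENNReal.inv_pos.2 (ENNReal.natCast_ne_top n)
  choose G t hGm hGi hcov hdiam hG using fun n =>
    exists_measurable_level_content hu hd (hrpos n)
      (ENNReal.lt_add_right hA (hrpos n).ne')
  refine ⟨fun s => liminf (fun n => G n s) atTop, Measurable.liminf hGm, fun s => ?_, ?_⟩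
  -- Only pieces meeting the level are indexed: for `d = 0` an empty piece would contribute `0 ^ 0 =
  -- 1`.
  · refine (Measure.hausdorffMeasure_le_liminf_tsum d (A ∩ u ⁻¹' {s}) r hr0
      (ι := fun n => {j // (t n j ∩ (A ∩ u ⁻¹' {s})).Nonempty})
      (fun n i => t n i ∩ (A ∩ u ⁻¹' {s})) ?_ ?_).trans ?_
    · exact Eventually.of_forall fun n i => (ediam_mono Set.inter_subset_left).trans (hdiam n i)
    · refine Eventually.of_forall fun n x hx => ?_
      obtain ⟨j, hj⟩ := Set.mem_iUnion.1 (hcov n hx.1)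
      exact Set.mem_iUnion.2 ⟨⟨j, x, hj, hx⟩, hj, hx⟩
    · exact liminf_le_liminf (Eventually.of_forall fun n => hG n s)
  · refine (lintegral_liminf_le hGm).trans ?_
    have h : Tendsto (fun n => L * (μH[d + 1] A + r n)) atTop (𝓝 (L * (μH[d + 1] A + 0))) :=
      ENNReal.Tendsto.const_mul (tendsto_const_nhds.add hr0) (Or.inr ENNReal.coe_ne_top)
    rw [add_zero] at h
    rw [← h.liminf_eq]
    exact liminf_le_liminf (Eventually.of_forall hGi)

theorem measurable_lipSlope (N : Set X) (u : X → ℝ) : Measurable (lipSlope N u) :=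
  (upperSemicontinuous_lipSlope N u).measurable

/-- A set on which the local Lipschitz constant is finite is covered by countably many measurable
pieces on which the function is Lipschitz with almost the local constant. -/
theorem exists_cover_lipschitzOn [SecondCountableTopology X] {N A : Set X} {u : X → ℝ}
    (hAN : A ⊆ N) (hfin : ∀ x ∈ A, lipSlope N u x < ⊤) {ε : ℝ≥0} (hε : 0 < ε) :
    ∃ C : ℕ → Set X, (∀ q, MeasurableSet (C q)) ∧ A ⊆ ⋃ q, C q ∧
      ∀ q, ∃ L : ℝ≥0, LipschitzOnWith L u (A ∩ C q) ∧
        ∀ y ∈ C q, (L : ℝ≥0∞) ≤ lipSlope N u y + ε := by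
  -- Slopes are sorted into steps of height `ε`: on a basic open set where `u` is `(m + 1)
  -- ε`-Lipschitz, only the points of slope at least `m ε` are kept. Inserting `∅` makes `P`
  -- nonempty, hence enumerable.
  set P : Set (ℕ × Set X) := {p | p.2 ∈ insert ∅ (TopologicalSpace.countableBasis X) ∧
    LipschitzOnWith ((p.1 + 1) * ε) u (A ∩ p.2)} with hP
  have hPc : P.Countable := by
    refine Set.Countable.mono ?_ ((Set.countable_univ (α := ℕ)).prod
      ((TopologicalSpace.countable_countableBasis X).insert ∅))
    exact fun p hp => ⟨Set.mem_univ _, hp.1⟩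
  have hPne : P.Nonempty := ⟨(0, ∅), Set.mem_insert _ _, by simp⟩
  obtain ⟨f, hf⟩ := hPc.exists_eq_range hPne
  have hfP : ∀ q, f q ∈ P := fun q => hf ▸ Set.mem_range_self q
  refine ⟨fun q => (f q).2 ∩ lipSlope N u ⁻¹' Set.Ici ((f q).1 * ε : ℝ≥0), fun q => ?_, ?_, ?_⟩
  · have : IsOpen (f q).2 := by
      rcases (hfP q).1 with h | h
      · exact h ▸ isOpen_empty
      · exact TopologicalSpace.isOpen_of_mem_countableBasis h
    exact this.measurableSet.inter (measurable_lipSlope N u measurableSet_Ici)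
  · intro x hx
    obtain ⟨m, hm⟩ : ∃ m : ℕ, (m * ε : ℝ≥0) ≤ lipSlope N u x ∧
        lipSlope N u x < ((m + 1) * ε : ℝ≥0) := by
      lift lipSlope N u x to ℝ≥0 using (hfin x hx).ne with Λ
      refine ⟨⌊Λ / ε⌋₊, ?_, ?_⟩
      · exact_mod_cast (le_div_iff₀ hε).1 (Nat.floor_le zero_le)
      · exact_mod_cast (div_lt_iff₀ hε).1 (Nat.lt_floor_add_one (Λ / ε))
    obtain ⟨L, hL, W, hW, hLip⟩ := lipSlope_lt_iff.1 hm.2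
    obtain ⟨B, hB, hxB, hBW⟩ :=
      (TopologicalSpace.isBasis_countableBasis X).mem_nhds_iff.1 hW
    have : (m, B) ∈ P := ⟨Or.inr hB, ((hLip.mono (Set.inter_subset_inter hAN hBW)).weaken
      (by exact_mod_cast hL.le))⟩
    rw [hf] at this
    obtain ⟨q, hq⟩ := this
    exact Set.mem_iUnion.2 ⟨q, by simpa only [hq] using hxB, by
      simpa only [hq, Set.mem_preimage, Set.mem_Ici] using hm.1⟩
  · intro q
    refine ⟨((f q).1 + 1) * ε, (hfP q).2.mono ?_, fun y hy => ?_⟩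
    · exact Set.inter_subset_inter_right _ Set.inter_subset_left
    · have := hy.2
      simp only [Set.mem_preimage, Set.mem_Ici] at this
      rw [add_mul, one_mul, ENNReal.coe_add]
      gcongr

/-- The Eilenberg inequality for locally Lipschitz functions, up to an error. -/
theorem exists_measurable_level_bound_add [SecondCountableTopology X] {N A : Set X} {u : X → ℝ}
    (hAN : A ⊆ N) (hfin : ∀ x ∈ A, lipSlope N u x < ⊤) {d : ℝ} (hd : 0 ≤ d)
    (hA : μH[d + 1] A ≠ ⊤) {ε : ℝ≥0} (hε : 0 < ε) :
    ∃ g : ℝ → ℝ≥0∞, Measurable g ∧ (∀ s, μH[d] (A ∩ u ⁻¹' {s}) ≤ g s) ∧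
      ∫⁻ s, g s ≤ ∫⁻ x in A, lipSlope N u x ∂μH[d + 1] + ε * μH[d + 1] A := by
  obtain ⟨C, hCm, hAC, hC⟩ := exists_cover_lipschitzOn hAN hfin hε
  choose L hL hLC using hC
  set D := disjointed C with hDdef
  have hDm : ∀ q, MeasurableSet (D q) := fun q => MeasurableSet.disjointed hCm q
  have hDC : ∀ q, D q ⊆ C q := disjointed_subset C
  have hAD : A ⊆ ⋃ q, D q := by rwa [hDdef, iUnion_disjointed]
  choose g hgm hg hgi using fun q => exists_measurable_level_bound_of_lipschitzOn
    ((hL q).mono (Set.inter_subset_inter_right A (hDC q))) hd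
    (measure_ne_top_of_subset Set.inter_subset_left hA)
  refine ⟨fun s => ∑' q, g q s, Measurable.tsum hgm, fun s => ?_, ?_⟩
  · calc μH[d] (A ∩ u ⁻¹' {s}) ≤ μH[d] (⋃ q, A ∩ D q ∩ u ⁻¹' {s}) := by
          refine measure_mono fun x hx => ?_
          obtain ⟨q, hq⟩ := Set.mem_iUnion.1 (hAD hx.1)
          exact Set.mem_iUnion.2 ⟨q, ⟨hx.1, hq⟩, hx.2⟩
      _ ≤ ∑' q, μH[d] (A ∩ D q ∩ u ⁻¹' {s}) := measure_iUnion_le _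
      _ ≤ _ := ENNReal.tsum_le_tsum fun q => hg q s
  · rw [lintegral_tsum fun q => (hgm q).aemeasurable]
    -- `A` need not be measurable; measurability of the pieces `D q` is enough.
    set μ : Measure X := μH[d + 1].restrict A with hμ
    calc ∑' q, ∫⁻ s, g q s ≤ ∑' q, ∫⁻ x in D q, (lipSlope N u x + ε) ∂μ := by
          refine ENNReal.tsum_le_tsum fun q => (hgi q).trans ?_
          rw [Set.inter_comm, ← Measure.restrict_apply (hDm q), ← setLIntegral_const]
          exact setLIntegral_mono ((measurable_lipSlope N u).add_const _)
            fun y hy => hLC q y (hDC q hy)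
      _ = ∫⁻ x in ⋃ q, D q, (lipSlope N u x + ε) ∂μ :=
          (lintegral_iUnion hDm (disjoint_disjointed C) _).symm
      _ ≤ ∫⁻ x, (lipSlope N u x + ε) ∂μ := setLIntegral_le_lintegral _ _
      _ = _ := by
          rw [lintegral_add_left (measurable_lipSlope N u), lintegral_const, hμ,
            Measure.restrict_apply_univ]

/-- The Eilenberg inequality for locally Lipschitz functions. -/
theorem exists_measurable_level_bound [SecondCountableTopology X] {N A : Set X} {u : X → ℝ}
    (hAN : A ⊆ N) (hfin : ∀ x ∈ A, lipSlope N u x < ⊤) {d : ℝ} (hd : 0 ≤ d)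
    (hA : μH[d + 1] A ≠ ⊤) :
    ∃ g : ℝ → ℝ≥0∞, Measurable g ∧ (∀ s, μH[d] (A ∩ u ⁻¹' {s}) ≤ g s) ∧
      ∫⁻ s, g s ≤ ∫⁻ x in A, lipSlope N u x ∂μH[d + 1] := by
  obtain ⟨e, -, he, he0⟩ := exists_seq_strictAnti_tendsto (0 : ℝ≥0)
  choose g hgm hg hgi using fun n =>
    exists_measurable_level_bound_add hAN hfin hd hA (he n)
  refine ⟨fun s => ⨅ n, g n s, Measurable.iInf hgm, fun s => le_iInf fun n => hg n s, ?_⟩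
  have h : Tendsto (fun n => ∫⁻ x in A, lipSlope N u x ∂μH[d + 1] + e n * μH[d + 1] A) atTop
      (𝓝 (∫⁻ x in A, lipSlope N u x ∂μH[d + 1] + (0 : ℝ≥0) * μH[d + 1] A)) :=
    tendsto_const_nhds.add
      (ENNReal.Tendsto.mul_const (ENNReal.tendsto_coe.2 he0) (Or.inr hA))
  rw [ENNReal.coe_zero, zero_mul, add_zero] at h
  exact ge_of_tendsto' h fun n => (lintegral_mono fun s => iInf_le _ n).trans (hgi n)

end Eilenberg

/-! ### Local parametrizations of submanifolds and first order estimates. -/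

section Param

variable {n k : ℕ} {N : Set (Euc n)} {x : Euc n}

/-- Near an interior point a submanifold is the image of a smooth map `g` defined near a point
of `ℝᵏ`, with a smooth left inverse `π` defined near the point in the ambient space. -/
structure IsLocalParam (N : Set (Euc n)) (x : Euc n) (g : Euc k → Euc n)
    (π : Euc n → Euc k) : Prop where
  contDiffAt : ContDiffAt ℝ ∞ g (π x)
  contDiffAt_inv : ContDiffAt ℝ ∞ π x
  mem : ∀ᶠ v in 𝓝 (π x), g v ∈ N
  left_inv : ∀ᶠ v in 𝓝 (π x), π (g v) = v
  right_inv : ∀ᶠ y in 𝓝[N] x, g (π y) = y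
  self_mem : x ∈ N

/-- Orthonormal coordinates on the model subspace `V` turn the chart into a parametrization;
orthogonal projection onto `V` extends the coordinates to the ambient space. -/
theorem IsInteriorPoint.exists_isLocalParam (h : IsInteriorPoint k N x) :
    ∃ (g : Euc k → Euc n) (π : Euc n → Euc k), IsLocalParam N x g π := by
  obtain ⟨Φ, V, hΦ, rfl, hx, hxN, hN⟩ := h
  set e := (stdOrthonormalBasis ℝ V).repr
  have hxV : Φ x ∈ V := (hN x hx).1 hxN
  have hpx : ((e.symm (e (V.orthogonalProjectionOnto (Φ x))) : V) : Euc n) = Φ x := by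
    rw [e.symm_apply_apply, Submodule.orthogonalProjectionOnto_mem_subspace_eq_self ⟨Φ x, hxV⟩]
  have hc : ContDiff ℝ ∞ fun v => ((e.symm v : V) : Euc n) :=
    V.subtypeL.contDiff.comp e.symm.contDiff
  have htgt : ∀ᶠ v in 𝓝 (e (V.orthogonalProjectionOnto (Φ x))),
      ((e.symm v : V) : Euc n) ∈ Φ.target := by
    refine hc.continuous.continuousAt.eventually_mem ?_
    rw [hpx]
    exact Φ.open_target.mem_nhds (Φ.map_source hx)
  refine ⟨fun v => Φ.symm (e.symm v : V), fun y => e (V.orthogonalProjectionOnto (Φ y)),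
    ?_, ?_, ?_, ?_, ?_, hxN⟩
  · refine ContDiffAt.comp (g := Φ.symm) _ ?_ hc.contDiffAt
    rw [hpx]
    exact hΦ.2.contDiffAt (Φ.open_target.mem_nhds (Φ.map_source hx))
  · exact (e.contDiff.comp V.orthogonalProjectionOnto.contDiff).contDiffAt.comp x
      (hΦ.1.contDiffAt (Φ.open_source.mem_nhds hx))
  · filter_upwards [htgt] with v hv
    rw [hN _ (Φ.map_target hv), Φ.right_inv hv]
    exact Submodule.coe_mem _
  · filter_upwards [htgt] with v hv
    rw [Φ.right_inv hv, Submodule.orthogonalProjectionOnto_mem_subspace_eq_self, e.apply_symm_apply]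
  · filter_upwards [self_mem_nhdsWithin,
      nhdsWithin_le_nhds (Φ.open_source.mem_nhds hx)] with y hyN hy
    rw [e.symm_apply_apply,
      Submodule.orthogonalProjectionOnto_mem_subspace_eq_self ⟨Φ y, (hN y hy).1 hyN⟩, Φ.left_inv hy]

theorem IsLocalParam.apply_self {g : Euc k → Euc n} {π : Euc n → Euc k}
    (h : IsLocalParam N x g π) : g (π x) = x :=
  h.right_inv.self_of_nhdsWithin h.self_mem

/-- A relatively open set whose points are all interior is Borel. -/
theorem measurableSet_of_forall_isInteriorPoint {U : Set (Euc n)} (hU : IsOpen U)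
    (h : ∀ x ∈ N ∩ U, IsInteriorPoint k N x) : MeasurableSet (N ∩ U) := by
  have key : ∀ x ∈ N ∩ U, ∃ W ∈ 𝓝 x, MeasurableSet (N ∩ U ∩ W) := by
    intro x hx
    obtain ⟨Φ, V, hΦ, -, hxs, -, hN⟩ := h x hx
    refine ⟨Φ.source, Φ.open_source.mem_nhds hxs, ?_⟩
    have h1 : IsOpen (Φ.source ∩ Φ ⁻¹' (V : Set (Euc n))ᶜ) :=
      Φ.continuousOn.isOpen_inter_preimage Φ.open_source
        V.closed_of_finiteDimensional.isOpen_compl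
    have h2 : N ∩ U ∩ Φ.source = (U ∩ Φ.source) \ (Φ.source ∩ Φ ⁻¹' (V : Set (Euc n))ᶜ) := by
      ext y
      have := hN y
      simp only [Set.mem_inter_iff, Set.mem_sdiff, Set.mem_preimage, Set.mem_compl_iff,
        SetLike.mem_coe]
      tauto
    rw [h2]
    exact (hU.inter Φ.open_source).measurableSet.diff h1.measurableSet
  choose! W hW hWm using key
  obtain ⟨t, htN, htc, ht⟩ := TopologicalSpace.countable_cover_nhdsWithin
    fun x hx => nhdsWithin_le_nhds (hW x hx)
  have : N ∩ U = ⋃ x ∈ t, N ∩ U ∩ W x := by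
    rw [← Set.inter_iUnion₂, Set.inter_eq_left.2 ht]
  rw [this]
  exact MeasurableSet.biUnion htc fun x hx => hWm x (htN hx)

/-- Relative neighbourhoods of interior points have positive `k`-dimensional measure. -/
theorem IsInteriorPoint.hausdorffMeasure_pos (h : IsInteriorPoint k N x) {W : Set (Euc n)}
    (hW : W ∈ 𝓝 x) : 0 < μH[(k : ℝ)] (N ∩ W) := by
  obtain ⟨g, π, hp⟩ := h.exists_isLocalParam
  obtain ⟨K, s, hs, hK⟩ :=
    (hp.contDiffAt_inv.hasStrictFDerivAt (by simp)).exists_lipschitzOnWith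
  have hgc : ∀ᶠ v in 𝓝 (π x), g v ∈ W ∩ s := by
    refine hp.contDiffAt.continuousAt.eventually_mem ?_
    rw [hp.apply_self]
    exact inter_mem hW hs
  -- A Lipschitz map would send a null set to a null set, but this image contains an open subset of
  -- `ℝᵏ`.
  have himg : π '' (N ∩ W ∩ s) ∈ 𝓝 (π x) := by
    filter_upwards [hgc, hp.mem, hp.left_inv] with v h1 h2 h3
    exact ⟨g v, ⟨⟨h2, h1.1⟩, h1.2⟩, h3⟩
  have : (μH[(k : ℝ)] : Measure (Euc k)).IsAddHaarMeasure := by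
    have := isAddHaarMeasure_hausdorffMeasure (E := Euc k)
    rwa [finrank_euclideanSpace_fin] at this
  have hpos : 0 < μH[(k : ℝ)] (π '' (N ∩ W ∩ s)) := Measure.measure_pos_of_mem_nhds _ himg
  have hle := (hK.mono (Set.inter_subset_right (s := N ∩ W))).hausdorffMeasure_image_le
    (Nat.cast_nonneg k)
  refine pos_of_ne_zero fun h0 => ?_
  rw [measure_mono_null Set.inter_subset_left h0, mul_zero] at hle
  exact hpos.not_ge hle

/-- Quantitative first order expansions along a submanifold. -/
theorem IsLocalParam.exists_nhds_estimates {g : Euc k → Euc n} {π : Euc n → Euc k}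
    (h : IsLocalParam N x g π) {f : Euc n → ℝ} {F' : Euc k →L[ℝ] ℝ}
    (hF : HasStrictFDerivAt (f ∘ g) F' (π x)) :
    ∃ K : ℝ≥0, ∀ c : ℝ≥0, 0 < c → ∃ W ∈ 𝓝 x, ∀ y ∈ N ∩ W, ∀ z ∈ N ∩ W,
      ‖π y - π z‖ ≤ K * ‖y - z‖ ∧
      ‖y - z - fderiv ℝ g (π x) (π y - π z)‖ ≤ c * ‖π y - π z‖ ∧
      ‖f y - f z - F' (π y - π z)‖ ≤ c * ‖π y - π z‖ := by
  obtain ⟨K, s, hs, hK⟩ :=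
    (h.contDiffAt_inv.hasStrictFDerivAt (by simp)).exists_lipschitzOnWith
  -- `K` is fixed before `c`, so `c` may later be chosen in terms of `K`.
  refine ⟨K, fun c hc => ?_⟩
  obtain ⟨s₁, hs₁, h₁⟩ := (h.contDiffAt.hasStrictFDerivAt
    (by simp)).approximates_deriv_on_nhds (Or.inr hc)
  obtain ⟨s₂, hs₂, h₂⟩ := hF.approximates_deriv_on_nhds (Or.inr hc)
  have hπ := h.contDiffAt_inv.continuousAt
  obtain ⟨W₀, hW₀, hW₀'⟩ := mem_nhdsWithin_iff_exists_mem_nhds_inter.1 h.right_inv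
  refine ⟨W₀ ∩ s ∩ π ⁻¹' (s₁ ∩ s₂), inter_mem (inter_mem hW₀ hs) (hπ (inter_mem hs₁ hs₂)),
    fun y hy z hz => ?_⟩
  have hgy : g (π y) = y := hW₀' ⟨hy.2.1.1, hy.1⟩
  have hgz : g (π z) = z := hW₀' ⟨hz.2.1.1, hz.1⟩
  refine ⟨?_, ?_, ?_⟩
  · simpa [dist_eq_norm] using hK.dist_le_mul _ hy.2.1.2 _ hz.2.1.2
  · simpa [hgy, hgz] using h₁ _ hy.2.2.1 _ hz.2.2.1
  · simpa [hgy, hgz] using h₂ _ hy.2.2.2 _ hz.2.2.2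

/-- With `a = π y - π z`, both first order expansions have error `c ‖a‖`, and `‖a‖ ≤ K ‖y - z‖`; so
`f` has Lipschitz constant `L + c (L + 1) K` near `x`, with `c` arbitrarily small. -/
theorem IsLocalParam.lipSlope_le {g : Euc k → Euc n} {π : Euc n → Euc k}
    (h : IsLocalParam N x g π) {f : Euc n → ℝ} {F' : Euc k →L[ℝ] ℝ}
    (hF : HasStrictFDerivAt (f ∘ g) F' (π x)) {L : ℝ≥0}
    (hL : ∀ v, ‖F' v‖ ≤ L * ‖fderiv ℝ g (π x) v‖) : lipSlope N f x ≤ L := by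
  obtain ⟨K, hK⟩ := h.exists_nhds_estimates hF
  refine ENNReal.le_of_forall_pos_le_add fun ε hε _ => ?_
  set c : ℝ≥0 := ε / ((L + 1) * K + 1) with hc
  obtain ⟨W, hW, hest⟩ := hK c (by positivity)
  refine iInf₂_le (L + ε) ⟨W, hW, LipschitzOnWith.of_dist_le_mul fun y hy z hz => ?_⟩
  obtain ⟨h1, h2, h3⟩ := hest y hy z hz
  rw [dist_eq_norm, dist_eq_norm]
  set a := π y - π z
  have hcK : (c : ℝ) * ((L + 1) * K) ≤ ε := by
    have : c * ((L + 1) * K + 1) = ε := div_mul_cancel₀ _ (by positivity)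
    have : (c : ℝ) * ((L + 1) * K + 1) = ε := by exact_mod_cast this
    nlinarith [c.2]
  have h4 : ‖fderiv ℝ g (π x) a‖ ≤ ‖y - z‖ + c * ‖a‖ := by
    have := norm_sub_norm_le (fderiv ℝ g (π x) a) (y - z)
    rw [norm_sub_rev (fderiv ℝ g (π x) a)] at this
    linarith
  have h5 : ‖f y - f z‖ ≤ ‖F' a‖ + c * ‖a‖ := by
    have := norm_sub_norm_le (f y - f z) (F' a)
    linarith
  have h6 : (c : ℝ) * ((L + 1) * ‖a‖) ≤ c * ((L + 1) * (K * ‖y - z‖)) := by gcongr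
  have h7 : L * ‖fderiv ℝ g (π x) a‖ ≤ L * (‖y - z‖ + c * ‖a‖) := by gcongr
  have h8 := mul_le_mul_of_nonneg_right hcK (norm_nonneg (y - z))
  push_cast
  linarith [hL a]

/-- `P` is injective on `S` with Lipschitz inverse, which extends to all of `ℝᵐ`. -/
theorem exists_lipschitz_subset_range {m : ℕ} {S : Set (Euc n)} (P : Euc n → Euc m) {C : ℝ≥0}
    (hP : ∀ y ∈ S, ∀ z ∈ S, ‖y - z‖ ≤ C * ‖P y - P z‖) :
    ∃ G : Euc m → Euc n, (∃ K : ℝ≥0, LipschitzWith K G) ∧ S ⊆ Set.range G := by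
  have hinv : ∀ y ∈ S, Function.invFunOn P S (P y) = y := by
    intro y hy
    have h1 := Function.invFunOn_mem (f := P) (s := S) ⟨y, hy, rfl⟩
    have h2 := Function.invFunOn_eq (f := P) (s := S) ⟨y, hy, rfl⟩
    have := hP _ h1 y hy
    rw [h2, sub_self, norm_zero, mul_zero] at this
    exact sub_eq_zero.1 (norm_le_zero_iff.1 this)
  have hLip : LipschitzOnWith C (Function.invFunOn P S) (P '' S) := by
    refine LipschitzOnWith.of_dist_le_mul ?_
    rintro _ ⟨y, hy, rfl⟩ _ ⟨z, hz, rfl⟩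
    rw [hinv y hy, hinv z hz, dist_eq_norm, dist_eq_norm]
    exact hP y hy z hz
  obtain ⟨G, hG, hGe⟩ := hLip.extend_finite_dimension
  exact ⟨G, ⟨_, hG⟩, fun y hy => ⟨P y, by rw [← hGe ⟨y, hy, rfl⟩, hinv y hy]⟩⟩

/-- Near a point where its differential does not vanish, the level set of a function on a
`k`-dimensional submanifold lies in a Lipschitz image of `ℝᵏ⁻¹`. -/
theorem IsLocalParam.level_subset_range {g : Euc k → Euc n} {π : Euc n → Euc k}
    (h : IsLocalParam N x g π) {f : Euc n → ℝ} {F' : Euc k →L[ℝ] ℝ}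
    (hF : HasStrictFDerivAt (f ∘ g) F' (π x)) (hF' : F' ≠ 0) :
    ∃ W ∈ 𝓝 x, ∃ G : Euc (k - 1) → Euc n, (∃ K : ℝ≥0, LipschitzWith K G) ∧
      N ∩ W ∩ f ⁻¹' {f x} ⊆ Set.range G := by
  set V : Submodule ℝ (Euc k) := LinearMap.ker (F' : Euc k →ₗ[ℝ] ℝ) with hV
  have hdim : Module.finrank ℝ V = k - 1 := by
    have := Module.Dual.finrank_ker_add_one_of_ne_zero (K := ℝ) (V₁ := Euc k)
      (f := (F' : Euc k →ₗ[ℝ] ℝ)) (fun h0 => hF' (ContinuousLinearMap.coe_injective h0))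
    rw [finrank_euclideanSpace_fin] at this
    exact Nat.eq_sub_of_add_eq this
  have e : V ≃ₗᵢ[ℝ] Euc (k - 1) := by
    rw [← hdim]; exact (stdOrthonormalBasis ℝ V).repr
  -- Projection to `ker F'` together with `F'` is injective, hence bounded below. Between two points
  -- of one level `F' a` is negligible, so the projection alone controls `a`.
  set T : Euc k →ₗ[ℝ] V × ℝ :=
    (V.orthogonalProjectionOnto : Euc k →ₗ[ℝ] V).prod (F' : Euc k →ₗ[ℝ] ℝ) with hT
  obtain ⟨K, hK0, hK⟩ := T.exists_antilipschitzWith (by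
    refine LinearMap.ker_eq_bot'.2 fun v hv => ?_
    have h1 : V.orthogonalProjectionOnto v = 0 := congrArg Prod.fst hv
    have h2 : v ∈ V := congrArg Prod.snd hv
    simpa using (Submodule.orthogonalProjectionOnto_mem_subspace_eq_self ⟨v, h2⟩).symm.trans h1)
  have hK' : ∀ v, ‖v‖ ≤ K * max ‖V.orthogonalProjectionOnto v‖ ‖F' v‖ := fun v => by
    have := hK.le_mul_dist v 0
    rw [map_zero, dist_zero_right, dist_zero_right] at this
    exact this
  obtain ⟨_, hest⟩ := h.exists_nhds_estimates hF
  -- With this error, if `F' a` realized the maximum one would get `‖a‖ ≤ ‖a‖ / 2`.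
  obtain ⟨W, hW, hest⟩ := hest (2 * K)⁻¹ (by positivity)
  refine ⟨W, hW, exists_lipschitz_subset_range (fun y => e (V.orthogonalProjectionOnto (π y)))
    (C := (‖fderiv ℝ g (π x)‖₊ + (2 * K)⁻¹) * K) fun y hy z hz => ?_⟩
  obtain ⟨-, h2, h3⟩ := hest y hy.1 z hz.1
  have hfyz : f y - f z = 0 := sub_eq_zero.2 (hy.2.trans hz.2.symm)
  rw [← map_sub, e.norm_map, ← map_sub]
  rw [hfyz, zero_sub, norm_neg] at h3
  set a := π y - π z
  have ha : ‖a‖ ≤ K * ‖V.orthogonalProjectionOnto a‖ := by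
    rcases le_total ‖F' a‖ ‖V.orthogonalProjectionOnto a‖ with hc | hc
    · exact (hK' a).trans_eq (by rw [max_eq_left hc])
    · have h4 := hK' a
      rw [max_eq_right hc] at h4
      have h5 : (K : ℝ) * ‖F' a‖ ≤ K * (((2 * K)⁻¹ : ℝ≥0) * ‖a‖) := by gcongr
      have h6 : (K : ℝ) * (((2 * K)⁻¹ : ℝ≥0) * ‖a‖) = ‖a‖ / 2 := by
        have : (K : ℝ) ≠ 0 := by exact_mod_cast hK0.ne'
        push_cast
        field_simp
      have : ‖a‖ ≤ 0 := by linarith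
      exact this.trans (by positivity)
  have h7 := norm_sub_norm_le (y - z) (fderiv ℝ g (π x) a)
  have h8 := (fderiv ℝ g (π x)).le_opNorm a
  calc ‖y - z‖ ≤ (‖fderiv ℝ g (π x)‖ + ((2 * K)⁻¹ : ℝ≥0)) * ‖a‖ := by linarith
    _ ≤ (‖fderiv ℝ g (π x)‖ + ((2 * K)⁻¹ : ℝ≥0)) * (K * ‖V.orthogonalProjectionOnto a‖) := by gcongr
    _ = _ := by push_cast; ring

/-- `g` maps a neighbourhood into `N`, so smoothness within `N` is enough, and values of
`fderivWithin` off the tangent directions do not matter after composition. -/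
theorem IsLocalParam.hasStrictFDerivAt_comp {g : Euc k → Euc n} {π : Euc n → Euc k}
    (h : IsLocalParam N x g π) {f : Euc n → ℝ} (hf : ContDiffWithinAt ℝ 1 f N x) :
    HasStrictFDerivAt (f ∘ g) ((fderivWithin ℝ f N x).comp (fderiv ℝ g (π x))) (π x) := by
  have hT : g ⁻¹' N ∈ 𝓝 (π x) := h.mem
  have hg1 : ContDiffAt ℝ 1 g (π x) := h.contDiffAt.of_le (by simp)
  have h1 : ContDiffAt ℝ 1 (f ∘ g) (π x) := by
    refine ContDiffWithinAt.contDiffAt (s := g ⁻¹' N) ?_ hT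
    refine ContDiffWithinAt.comp (t := N) _ ?_ hg1.contDiffWithinAt (Set.mapsTo_preimage g N)
    rwa [h.apply_self]
  have h2 : HasFDerivAt (f ∘ g) ((fderivWithin ℝ f N x).comp (fderiv ℝ g (π x))) (π x) := by
    refine HasFDerivWithinAt.hasFDerivAt (s := g ⁻¹' N) ?_ hT
    refine HasFDerivWithinAt.comp (t := N) _ ?_
      (hg1.differentiableAt (by simp)).hasFDerivAt.hasFDerivWithinAt (Set.mapsTo_preimage g N)
    rw [h.apply_self]
    exact (hf.differentiableWithinAt (by simp)).hasFDerivWithinAt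
  have := h1.hasStrictFDerivAt (by simp)
  rwa [h2.fderiv] at this

theorem IsLocalParam.fderiv_mem_tangentSpaceAt {g : Euc k → Euc n} {π : Euc n → Euc k}
    (h : IsLocalParam N x g π) (v : Euc k) : fderiv ℝ g (π x) v ∈ tangentSpaceAt N x := by
  refine Submodule.subset_span ?_
  have hT : g ⁻¹' N ∈ 𝓝 (π x) := h.mem
  have h1 := (h.contDiffAt.differentiableAt (by simp)).hasFDerivAt.hasFDerivWithinAt
    (s := g ⁻¹' N)
  have h2 := h1.mapsTo_tangent_cone (show v ∈ _ by
    rw [tangentConeAt_of_mem_nhds hT]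
    trivial)
  rw [h.apply_self] at h2
  exact tangentConeAt_mono (Set.image_preimage_subset g N) h2

/-- The local Lipschitz constant of a smooth function on a submanifold is at most the norm of
its gradient. -/
theorem IsInteriorPoint.lipSlope_le_gradient (h : IsInteriorPoint k N x) {f : Euc n → ℝ}
    (hf : ContDiffWithinAt ℝ 1 f N x) : lipSlope N f x ≤ ‖tangentialGradient N f x‖ₑ := by
  obtain ⟨g, π, hp⟩ := h.exists_isLocalParam
  refine hp.lipSlope_le (L := ‖tangentialGradient N f x‖₊) (hp.hasStrictFDerivAt_comp hf)
    fun v => ?_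
  have h1 := (tangentialDifferential N f x).le_opNorm ⟨_, hp.fderiv_mem_tangentSpaceAt v⟩
  rw [coe_nnnorm, tangentialGradient, LinearIsometryEquiv.norm_map]
  exact h1

/-- At an interior point, either the local Lipschitz constant of a smooth function vanishes, or
its level set is locally contained in a Lipschitz image of `ℝᵏ⁻¹`. -/
theorem IsInteriorPoint.lipSlope_eq_zero_or (h : IsInteriorPoint k N x) {f : Euc n → ℝ}
    (hf : ContDiffWithinAt ℝ 1 f N x) : lipSlope N f x = 0 ∨
      ∃ W ∈ 𝓝 x, ∃ G : Euc (k - 1) → Euc n, (∃ K : ℝ≥0, LipschitzWith K G) ∧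
        N ∩ W ∩ f ⁻¹' {f x} ⊆ Set.range G := by
  obtain ⟨g, π, hp⟩ := h.exists_isLocalParam
  have hF := hp.hasStrictFDerivAt_comp hf
  by_cases h0 : (fderivWithin ℝ f N x).comp (fderiv ℝ g (π x)) = 0
  · left
    rw [h0] at hF
    simpa using hp.lipSlope_le (L := 0) hF (by simp)
  · exact Or.inr (hp.level_subset_range hF h0)

theorem IsInteriorPoint.lipSlope_lt_top (h : IsInteriorPoint k N x) {f : Euc n → ℝ}
    (hf : ContDiffWithinAt ℝ 1 f N x) : lipSlope N f x < ⊤ :=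
  (h.lipSlope_le_gradient hf).trans_lt enorm_lt_top

end Param

/-! ### Rectifiability of almost every level set. -/

section Level

variable {n k : ℕ} {N A : Set (Euc n)} {u : Euc n → ℝ}

theorem exists_measurable_level_bound_nat (hk : 1 ≤ k) (hAN : A ⊆ N)
    (hfin : ∀ x ∈ A, lipSlope N u x < ⊤) (hA : μH[(k : ℝ)] A ≠ ⊤) :
    ∃ g : ℝ → ℝ≥0∞, Measurable g ∧ (∀ s, μH[((k - 1 : ℕ) : ℝ)] (A ∩ u ⁻¹' {s}) ≤ g s) ∧
      ∫⁻ s, g s ≤ ∫⁻ x in A, lipSlope N u x ∂μH[(k : ℝ)] := by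
  have hk' : ((k - 1 : ℕ) : ℝ) + 1 = k := by exact_mod_cast Nat.sub_add_cancel hk
  have := exists_measurable_level_bound hAN hfin (d := ((k - 1 : ℕ) : ℝ)) (Nat.cast_nonneg _)
    (by rwa [hk'])
  rwa [hk'] at this

theorem IsCountablyRectifiable.mono {m : ℕ} {S T : Set (Euc n)} (h : IsCountablyRectifiable m T)
    (hST : S ⊆ T) : IsCountablyRectifiable m S := by
  obtain ⟨F, hF, h0⟩ := h
  exact ⟨F, hF, measure_mono_null (Set.sdiff_subset_sdiff_left hST) h0⟩

theorem IsCountablyRectifiable.union {m : ℕ} {S T : Set (Euc n)}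
    (hS : IsCountablyRectifiable m S) (hT : IsCountablyRectifiable m T) :
    IsCountablyRectifiable m (S ∪ T) := by
  obtain ⟨F, hF, hF0⟩ := hS
  obtain ⟨G, hG, hG0⟩ := hT
  refine ⟨fun j => Sum.elim F G (Equiv.natSumNatEquivNat.symm j), fun j => ?_, ?_⟩
  · rcases hi : Equiv.natSumNatEquivNat.symm j with i | i
    · simpa [hi] using hF i
    · simpa [hi] using hG i
  · refine measure_mono_null ?_ (measure_union_null hF0 hG0)
    rintro x ⟨hx, hx'⟩
    simp only [Set.mem_iUnion, not_exists] at hx'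
    refine hx.imp (fun h => ⟨h, fun h' => ?_⟩) fun h => ⟨h, fun h' => ?_⟩
    · obtain ⟨i, hi⟩ := Set.mem_iUnion.1 h'
      exact hx' (Equiv.natSumNatEquivNat (Sum.inl i)) (by simpa using hi)
    · obtain ⟨i, hi⟩ := Set.mem_iUnion.1 h'
      exact hx' (Equiv.natSumNatEquivNat (Sum.inr i)) (by simpa using hi)

theorem isCountablyRectifiable_empty {m : ℕ} : IsCountablyRectifiable m (∅ : Set (Euc n)) :=
  ⟨fun _ _ => 0, fun _ => ⟨0, LipschitzWith.const 0⟩, by simp⟩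

/-- Almost every level set of a smooth function on a submanifold is rectifiable. -/
theorem ae_isCountablyRectifiable_level (hk : 1 ≤ k) (hAN : A ⊆ N)
    (hint : ∀ x ∈ A, IsInteriorPoint k N x) (hu : ∀ x ∈ A, ContDiffWithinAt ℝ 1 u N x)
    (hA : μH[(k : ℝ)] A ≠ ⊤) :
    ∀ᵐ s, IsCountablyRectifiable (k - 1) (A ∩ u ⁻¹' {s}) := by
  -- A substitute for Sard's theorem needing only `C¹`: the Eilenberg inequality on `Z`, where the
  -- slope vanishes, shows that almost every level meets `Z` in an `ℋᵏ⁻¹`-null set.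
  set Z := A ∩ lipSlope N u ⁻¹' {0} with hZ
  obtain ⟨g, hgm, hg, hgi⟩ := exists_measurable_level_bound_nat (A := Z) (u := u) hk
    (Set.inter_subset_left.trans hAN)
    (fun x hx => (hint x hx.1).lipSlope_lt_top (hu x hx.1))
    (measure_ne_top_of_subset Set.inter_subset_left hA)
  have h0 : ∫⁻ x in Z, lipSlope N u x ∂μH[(k : ℝ)] = 0 := by
    rw [lintegral_eq_zero_iff (measurable_lipSlope N u), hZ, Set.inter_comm,
      ← Measure.restrict_restrict (measurable_lipSlope N u (measurableSet_singleton 0))]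
    exact ae_restrict_of_forall_mem (measurable_lipSlope N u (measurableSet_singleton 0))
      fun x hx => hx
  rw [h0, nonpos_iff_eq_zero, lintegral_eq_zero_iff hgm] at hgi
  filter_upwards [hgi] with s hs
  have hZs : μH[((k - 1 : ℕ) : ℝ)] (Z ∩ u ⁻¹' {s}) = 0 := le_antisymm ((hg s).trans hs.le) bot_le
  -- Off `Z` the differential is nonzero, and by Lindelöf countably many local Lipschitz images
  -- suffice.
  have key : ∀ x ∈ (A \ Z) ∩ u ⁻¹' {s}, ∃ W ∈ 𝓝 x, ∃ G : Euc (k - 1) → Euc n,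
      (∃ K : ℝ≥0, LipschitzWith K G) ∧ N ∩ W ∩ u ⁻¹' {u x} ⊆ Set.range G := fun x hx =>
    ((hint x hx.1.1).lipSlope_eq_zero_or (hu x hx.1.1)).resolve_left
      fun h => hx.1.2 ⟨hx.1.1, h⟩
  choose! W hW G hG hWG using key
  obtain ⟨t, htA, htc, ht⟩ := TopologicalSpace.countable_cover_nhdsWithin
    fun x hx => nhdsWithin_le_nhds (hW x hx)
  rcases t.eq_empty_or_nonempty with rfl | htne
  · refine ⟨fun _ _ => 0, fun _ => ⟨0, LipschitzWith.const 0⟩, measure_mono_null ?_ hZs⟩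
    rintro x ⟨⟨hxA, hxs⟩, -⟩
    by_contra hx
    simpa using ht ⟨⟨hxA, fun h => hx ⟨h, hxs⟩⟩, hxs⟩
  · obtain ⟨c, rfl⟩ := htc.exists_eq_range htne
    refine ⟨fun j => G (c j), fun j => hG _ (htA ⟨j, rfl⟩), measure_mono_null ?_ hZs⟩
    rintro x ⟨⟨hxA, hxs⟩, hx'⟩
    by_contra hx
    obtain ⟨j, hj⟩ : ∃ j, x ∈ W (c j) := by
      simpa using ht ⟨⟨hxA, fun h => hx ⟨h, hxs⟩⟩, hxs⟩
    have hcj := htA ⟨j, rfl⟩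
    exact hx' (Set.mem_iUnion.2 ⟨j, hWG _ hcj ⟨⟨hAN hxA, hj⟩, hxs.trans hcj.2.symm⟩⟩)

end Level

/-! ### Volume growth from the isoperimetric inequality. -/

section Growth

/-- The chord bound for the convex function `(1 + y) ^ (j + 1)` on `[0, 1]`, with `y = x / w`; it is
the source of the factor `2 ^ k` in `pow_le_of_growth`. -/
theorem add_pow_succ_le {w x : ℝ} (hx : 0 ≤ x) (hxw : x ≤ w) (j : ℕ) :
    (w + x) ^ (j + 1) ≤ w ^ (j + 1) + (2 ^ (j + 1) - 1) * x * w ^ j := by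
  have hw : 0 ≤ w := hx.trans hxw
  induction j with
  | zero => norm_num
  | succ j ih =>
    have h2 : (0 : ℝ) ≤ 2 ^ (j + 1) - 1 := by
      have := one_le_pow₀ (M₀ := ℝ) one_le_two (n := j + 1)
      linarith
    calc (w + x) ^ (j + 1 + 1) = (w + x) ^ (j + 1) * (w + x) := pow_succ _ _
      _ ≤ (w ^ (j + 1) + (2 ^ (j + 1) - 1) * x * w ^ j) * (w + x) := by gcongr
      _ = w ^ (j + 2) + x * w ^ (j + 1) + (2 ^ (j + 1) - 1) * x * w ^ (j + 1)
          + (2 ^ (j + 1) - 1) * x * w ^ j * x := by ring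
      _ ≤ w ^ (j + 2) + x * w ^ (j + 1) + (2 ^ (j + 1) - 1) * x * w ^ (j + 1)
          + (2 ^ (j + 1) - 1) * x * w ^ j * w := by gcongr
      _ = _ := by ring

/-- A function satisfying a discrete form of `V' ≥ c V^((k-1)/k)` grows like a `k`-th power. -/
theorem pow_le_of_growth {V : ℝ → ℝ} {k : ℕ} (hk : 1 ≤ k) {c a b : ℝ} (hc : 0 < c) (hab : a ≤ b)
    (ha : 0 < V a)
    (hV : ∀ s t, a ≤ s → s ≤ t → t ≤ b → V s + c * (t - s) * V s ^ (((k : ℝ) - 1) / k) ≤ V t) :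
    (c / 2 ^ k * (b - a)) ^ k ≤ V b := by
  obtain ⟨j, rfl⟩ : ∃ j, k = j + 1 := ⟨k - 1, by omega⟩
  have hVa : ∀ s, a ≤ s → s ≤ b → V a ≤ V s := fun s h1 h2 => by
    refine le_trans ?_ (hV a s le_rfl h1 h2)
    have : 0 ≤ c * (s - a) * V a ^ ((((j + 1 : ℕ) : ℝ) - 1) / (j + 1 : ℕ)) :=
      mul_nonneg (mul_nonneg hc.le (sub_nonneg.2 h1)) (Real.rpow_nonneg ha.le _)
    linarith
  -- For `w = V^(1/k)` the growth becomes linear with slope `c₁`, but the chord bound allows only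
  -- steps with `c₁ (t - s) ≤ w a`; hence the subdivision into `m` steps below.
  set w : ℝ → ℝ := fun s => V s ^ (((j + 1 : ℕ) : ℝ)⁻¹) with hw
  have hwpow : ∀ s, a ≤ s → s ≤ b → w s ^ (j + 1) = V s := fun s h1 h2 =>
    Real.rpow_inv_natCast_pow (ha.le.trans (hVa s h1 h2)) (by omega)
  have hwpow' : ∀ s, a ≤ s → s ≤ b → V s ^ ((((j + 1 : ℕ) : ℝ) - 1) / (j + 1 : ℕ)) = w s ^ j := by
    intro s h1 h2
    rw [hw, ← Real.rpow_natCast, ← Real.rpow_mul (ha.le.trans (hVa s h1 h2))]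
    congr 1
    push_cast
    ring
  have hwa : 0 < w a := Real.rpow_pos_of_pos ha _
  have hwas : ∀ s, a ≤ s → s ≤ b → w a ≤ w s := fun s h1 h2 =>
    Real.rpow_le_rpow ha.le (hVa s h1 h2) (by positivity)
  set c₁ : ℝ := c / 2 ^ (j + 1) with hc₁
  have hc₁pos : 0 < c₁ := by positivity
  have hstep : ∀ s t, a ≤ s → s ≤ t → t ≤ b → c₁ * (t - s) ≤ w a → w s + c₁ * (t - s) ≤ w t := by
    intro s t h1 h2 h3 h4
    have h0 : 0 ≤ c₁ * (t - s) := mul_nonneg hc₁pos.le (sub_nonneg.2 h2)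
    have hws := hwas s h1 (h2.trans h3)
    have hwt := hwas t (h1.trans h2) h3
    refine le_of_pow_le_pow_left₀ (n := j + 1) (by omega) (hwa.le.trans hwt) ?_
    have h5 := hV s t h1 h2 h3
    rw [hwpow' s h1 (h2.trans h3), ← hwpow s h1 (h2.trans h3), ← hwpow t (h1.trans h2) h3] at h5
    refine (add_pow_succ_le h0 (h4.trans hws) j).trans (le_trans ?_ h5)
    have h6 : (2 ^ (j + 1) - 1) * (c₁ * (t - s)) ≤ c * (t - s) := by
      have : 2 ^ (j + 1) * c₁ = c := mul_div_cancel₀ _ (by positivity)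
      calc (2 ^ (j + 1) - 1) * (c₁ * (t - s)) = 2 ^ (j + 1) * c₁ * (t - s) - c₁ * (t - s) := by ring
        _ ≤ c * (t - s) := by rw [this]; linarith
    have := mul_le_mul_of_nonneg_right h6 (pow_nonneg (hwa.le.trans hws) j)
    linarith
  obtain ⟨m, hm⟩ := exists_nat_gt (c₁ * (b - a) / w a)
  have hm0 : (0 : ℝ) < m := (div_nonneg (mul_nonneg hc₁pos.le (sub_nonneg.2 hab)) hwa.le).trans_lt hm
  set h : ℝ := (b - a) / m with hh
  have hh0 : 0 ≤ h := div_nonneg (sub_nonneg.2 hab) hm0.le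
  have hmh : m * h = b - a := mul_div_cancel₀ _ hm0.ne'
  have hsmall : c₁ * h ≤ w a := by
    rw [div_lt_iff₀ hwa] at hm
    rw [hh, ← mul_div_assoc, div_le_iff₀ hm0]
    linarith
  have hiter : ∀ i : ℕ, i ≤ m → c₁ * (i * h) ≤ w (a + i * h) := by
    intro i
    induction i with
    | zero => intro _; simpa using hwa.le
    | succ i ih =>
      intro hi
      have him : (((i + 1 : ℕ) : ℝ)) * h ≤ m * h := by gcongr
      have h1 := ih (by omega)
      have hi0 : (0 : ℝ) ≤ i * h := by positivity
      have h2 := hstep (a + i * h) (a + (i + 1 : ℕ) * h) (by linarith)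
        (by push_cast; linarith) (by linarith) (by push_cast; ring_nf; linarith)
      push_cast at h2 ⊢
      linarith
  have hfin := hiter m le_rfl
  rw [hmh, add_sub_cancel] at hfin
  calc (c₁ * (b - a)) ^ (j + 1) ≤ w b ^ (j + 1) :=
        pow_le_pow_left₀ (mul_nonneg hc₁pos.le (sub_nonneg.2 hab)) hfin _
    _ = V b := hwpow b hab le_rfl

variable {n k : ℕ} {N U B S : Set (Euc n)} {u : Euc n → ℝ} {x₀ : Euc n} {T : ℝ}

/-- The boundary of a sublevel set inside a relatively open set `B`. -/
theorem relBoundary_sublevel_subset (hU : IsOpen U) (hu : ContinuousOn u (N ∩ U))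
    (hB : ∃ O, IsOpen O ∧ B = O ∩ (N ∩ U)) (hdist : ∀ y, dist y x₀ ≤ u y) (hT : ball x₀ T ⊆ U)
    (hS : (N ∩ U ∩ closure B) \ B ⊆ S) {r : ℝ} (hr : r < T) :
    relBoundary N (B ∩ u ⁻¹' Set.Iio r) ⊆ S ∪ B ∩ u ⁻¹' {r} := by
  obtain ⟨O, hO, rfl⟩ := hB
  rintro y ⟨⟨hyN, hyc⟩, hyc'⟩
  -- Because `u` dominates the distance, the sublevel set cannot reach the edge of `U`.
  have hyr : dist y x₀ ≤ r := by
    have : closure (O ∩ (N ∩ U) ∩ u ⁻¹' Set.Iio r) ⊆ closedBall x₀ r :=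
      closure_minimal (fun z hz => (hdist z).trans (le_of_lt hz.2)) isClosed_closedBall
    exact this hyc
  have hyM : y ∈ N ∩ U := ⟨hyN, hT (hyr.trans_lt hr)⟩
  have huy : u y ≤ r := by
    have h1 : ContinuousWithinAt u (O ∩ (N ∩ U) ∩ u ⁻¹' Set.Iio r) y :=
      (hu y hyM).mono fun z hz => hz.1.2
    refine closure_minimal ?_ isClosed_Iic (h1.mem_closure_image hyc)
    rintro _ ⟨z, hz, rfl⟩
    exact Set.Iio_subset_Iic_self hz.2
  by_cases hyB : y ∈ O ∩ (N ∩ U)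
  · right
    -- A point of `B` with `u y < r` has a relative neighbourhood inside the sublevel set, so it is
    -- no boundary point.
    refine ⟨hyB, huy.eq_of_not_lt fun hlt => ?_⟩
    obtain ⟨O', hO', hOO'⟩ := (_root_.continuousOn_iff'.1 hu) (Set.Iio r) isOpen_Iio
    have hyO' : y ∈ O' := (hOO'.subset ⟨hlt, hyM⟩).1
    obtain ⟨z, ⟨⟨hzO, hzO'⟩, hzU⟩, hzN, hz⟩ := mem_closure_iff.1 hyc' (O ∩ O' ∩ U)
      ((hO.inter hO').inter hU) ⟨⟨hyB.1, hyO'⟩, hyM.2⟩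
    exact hz ⟨⟨hzO, hzN, hzU⟩, (hOO'.symm.subset ⟨hzO', hzN, hzU⟩).1⟩
  · exact Or.inl (hS ⟨⟨hyM, closure_mono Set.inter_subset_left hyc⟩, hyB⟩)

theorem exists_isOpen_sublevel (hu : ContinuousOn u (N ∩ U))
    (hB : ∃ O, IsOpen O ∧ B = O ∩ (N ∩ U)) (r : ℝ) :
    ∃ O, IsOpen O ∧ B ∩ u ⁻¹' Set.Iio r = O ∩ (N ∩ U) := by
  obtain ⟨O, hO, rfl⟩ := hB
  obtain ⟨O', hO', hOO'⟩ := (_root_.continuousOn_iff'.1 hu) (Set.Iio r) isOpen_Iio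
  refine ⟨O ∩ O', hO.inter hO', ?_⟩
  rw [Set.inter_assoc, Set.inter_comm (N ∩ U), hOO', Set.inter_assoc]

/-- The isoperimetric inequality and the Eilenberg inequality bound the measure of sublevel sets
of a distance-like function from below. -/
theorem pow_le_measure_sublevel (hk : 1 ≤ k) (hU : IsOpen U)
    (hint : ∀ x ∈ N ∩ U, IsInteriorPoint k N x) (hfin : μH[(k : ℝ)] (N ∩ U) ≠ ⊤)
    {D : ℝ} (hD : 0 < D) (hiso : IsoperimetricInequality k D N U)
    (hu : ContinuousOn u (N ∩ U)) (hslope : ∀ x ∈ N ∩ U, lipSlope N u x ≤ 1)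
    (hdist : ∀ y, dist y x₀ ≤ u y) (hT : ball x₀ T ⊆ U)
    (hrect : ∀ᵐ r, IsCountablyRectifiable (k - 1) (N ∩ U ∩ u ⁻¹' {r}))
    (hB : ∃ O, IsOpen O ∧ B = O ∩ (N ∩ U))
    (hS : (N ∩ U ∩ closure B) \ B ⊆ S) (hSrect : IsCountablyRectifiable (k - 1) S)
    {η : ℝ} (hη : 0 ≤ η) (hSη : μH[((k - 1 : ℕ) : ℝ)] S ≤ ENNReal.ofReal η)
    {a b : ℝ} (hab : a ≤ b) (hbT : b < T)
    (ha : 0 < (μH[(k : ℝ)] (B ∩ u ⁻¹' Set.Iio a)).toReal)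
    (haη : 2 * D * η ≤ (μH[(k : ℝ)] (B ∩ u ⁻¹' Set.Iio a)).toReal ^ (((k : ℝ) - 1) / k)) :
    (1 / (2 * D) / 2 ^ k * (b - a)) ^ k ≤ (μH[(k : ℝ)] (B ∩ u ⁻¹' Set.Iio b)).toReal := by
  set p : ℝ := ((k : ℝ) - 1) / k with hp
  have hp0 : 0 ≤ p := div_nonneg (sub_nonneg.2 (by exact_mod_cast hk)) (Nat.cast_nonneg k)
  have hBM : B ⊆ N ∩ U := by
    obtain ⟨O, -, rfl⟩ := hB
    exact Set.inter_subset_right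
  have hMm : MeasurableSet (N ∩ U) := measurableSet_of_forall_isInteriorPoint hU hint
  set E : ℝ → Set (Euc n) := fun r => B ∩ u ⁻¹' Set.Iio r with hE
  have hEm : ∀ r, MeasurableSet (E r) := fun r => by
    obtain ⟨O, hO, h⟩ := exists_isOpen_sublevel hu hB r
    rw [hE]
    simp only [h]
    exact hO.measurableSet.inter hMm
  have hEM : ∀ r, E r ⊆ N ∩ U := fun r => Set.inter_subset_left.trans hBM
  have hEfin : ∀ r, μH[(k : ℝ)] (E r) ≠ ⊤ := fun r => measure_ne_top_of_subset (hEM r) hfin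
  have hEmono : ∀ s t, s ≤ t → E s ⊆ E t := fun s t hst =>
    Set.inter_subset_inter_right _ (Set.preimage_mono (Set.Iio_subset_Iio hst))
  refine pow_le_of_growth (V := fun r => (μH[(k : ℝ)] (E r)).toReal) hk (by positivity) hab ha
    fun s t has hst htb => ?_
  have hVs : (μH[(k : ℝ)] (E a)).toReal ≤ (μH[(k : ℝ)] (E s)).toReal :=
    ENNReal.toReal_mono (hEfin s) (measure_mono (hEmono a s has))
  -- The slope is at most one, so the levels between `s` and `t` have total measure at most that of
  -- the shell `C`; the isoperimetric inequality bounds each of them from below.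
  set C : Set (Euc n) := E t \ E s with hC
  obtain ⟨g, hgm, hg, hgi⟩ := exists_measurable_level_bound_nat (A := C) (N := N) (u := u) hk
    (Set.sdiff_subset.trans ((hEM t).trans Set.inter_subset_left))
    (fun x hx => (hslope x (hEM t hx.1)).trans_lt ENNReal.one_lt_top)
    (measure_ne_top_of_subset (Set.sdiff_subset.trans (hEM t)) hfin)
  have hgC : ∫⁻ r, g r ≤ μH[(k : ℝ)] C := by
    refine hgi.trans ?_
    rw [← setLIntegral_one]
    exact setLIntegral_mono measurable_const fun x hx => hslope x (hEM t hx.1)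
  have hCV : (μH[(k : ℝ)] C).toReal = (μH[(k : ℝ)] (E t)).toReal - (μH[(k : ℝ)] (E s)).toReal := by
    rw [hC, measure_sdiff (hEmono s t hst) (hEm s).nullMeasurableSet (hEfin s),
      ENNReal.toReal_sub_of_le (measure_mono (hEmono s t hst)) (hEfin t)]
  have hpt : ∀ᵐ r, r ∈ Set.Ico s t →
      μH[(k : ℝ)] (E s) ^ p ≤ ENNReal.ofReal D * (ENNReal.ofReal η + g r) := by
    filter_upwards [hrect] with r hr hrst
    have hbd := relBoundary_sublevel_subset hU hu hB hdist hT hS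
      (hrst.2.trans_le htb |>.trans hbT)
    have hpos : (E r).Nonempty := by
      have h0 : μH[(k : ℝ)] (E a) ≠ 0 := fun h0 => by
        simp only [hE] at h0
        simp [h0] at ha
      exact (nonempty_of_measure_ne_zero h0).mono (hEmono a r (has.trans hrst.1))
    have hsub : B ∩ u ⁻¹' {r} ⊆ C ∩ u ⁻¹' {r} := by
      rintro y ⟨hyB, hyr⟩
      have hyr' : u y = r := hyr
      exact ⟨⟨⟨hyB, hyr'.trans_lt hrst.2⟩, fun h => absurd (hyr'.symm.trans_lt h.2)
        hrst.1.not_gt⟩, hyr⟩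
    calc μH[(k : ℝ)] (E s) ^ p ≤ μH[(k : ℝ)] (E r) ^ p :=
          ENNReal.rpow_le_rpow (measure_mono (hEmono s r hrst.1)) hp0
      _ ≤ ENNReal.ofReal D * μH[((k - 1 : ℕ) : ℝ)] (relBoundary N (E r)) :=
          hiso (E r) hpos (hEM r) (exists_isOpen_sublevel hu hB r)
            ((hSrect.union (hr.mono (Set.inter_subset_inter_left _ hBM))).mono hbd)
      _ ≤ ENNReal.ofReal D * (ENNReal.ofReal η + g r) := by
          gcongr
          calc _ ≤ μH[((k - 1 : ℕ) : ℝ)] (S ∪ B ∩ u ⁻¹' {r}) := measure_mono hbd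
            _ ≤ μH[((k - 1 : ℕ) : ℝ)] S + μH[((k - 1 : ℕ) : ℝ)] (B ∩ u ⁻¹' {r}) :=
                measure_union_le _ _
            _ ≤ _ := add_le_add hSη ((measure_mono hsub).trans (hg r))
  have hint' : μH[(k : ℝ)] (E s) ^ p * ENNReal.ofReal (t - s) ≤
      ENNReal.ofReal D * (ENNReal.ofReal η * ENNReal.ofReal (t - s) + μH[(k : ℝ)] C) := by
    calc _ = ∫⁻ _ in Set.Ico s t, μH[(k : ℝ)] (E s) ^ p := by
          rw [setLIntegral_const, Real.volume_Ico]
      _ ≤ ∫⁻ r in Set.Ico s t, ENNReal.ofReal D * (ENNReal.ofReal η + g r) :=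
          setLIntegral_mono_ae (by fun_prop) hpt
      _ = ENNReal.ofReal D * (ENNReal.ofReal η * ENNReal.ofReal (t - s)
            + ∫⁻ r in Set.Ico s t, g r) := by
          rw [lintegral_const_mul _ (by fun_prop), lintegral_add_left measurable_const,
            setLIntegral_const, Real.volume_Ico]
      _ ≤ _ := by
          gcongr
          exact (setLIntegral_le_lintegral _ _).trans hgC
  have hreal : (μH[(k : ℝ)] (E s)).toReal ^ p * (t - s) ≤
      D * (η * (t - s) + ((μH[(k : ℝ)] (E t)).toReal - (μH[(k : ℝ)] (E s)).toReal)) := by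
    have hCfin : μH[(k : ℝ)] C ≠ ⊤ := measure_ne_top_of_subset Set.sdiff_subset (hEfin t)
    have h1 := ENNReal.toReal_mono (by finiteness) hint'
    rwa [ENNReal.toReal_mul, ENNReal.toReal_mul, ENNReal.toReal_add (by finiteness) hCfin,
      ENNReal.toReal_mul, ENNReal.toReal_ofReal hD.le, ENNReal.toReal_ofReal hη,
      ENNReal.toReal_ofReal (sub_nonneg.2 hst), ← ENNReal.toReal_rpow, hCV] at h1
  -- Half of the isoperimetric left-hand side absorbs the contribution of `S`; the other half gives
  -- the growth constant `1 / (2 D)`.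
  have hle : 2 * D * η ≤ (μH[(k : ℝ)] (E s)).toReal ^ p :=
    haη.trans (Real.rpow_le_rpow ENNReal.toReal_nonneg hVs hp0)
  have h2 := mul_le_mul_of_nonneg_right hle (sub_nonneg.2 hst)
  have h3 : 1 / (2 * D) * (t - s) * (μH[(k : ℝ)] (E s)).toReal ^ p ≤
      (μH[(k : ℝ)] (E t)).toReal - (μH[(k : ℝ)] (E s)).toReal := by
    rw [mul_assoc, one_div, inv_mul_le_iff₀ (by positivity)]
    linarith
  linarith

end Growth

/-! ### Lower bounds for bands between levels, and the oscillation estimate. -/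

section Bands

variable {n k : ℕ} {N U : Set (Euc n)} {f : Euc n → ℝ} {x₀ : Euc n} {T : ℝ}

theorem lipSlope_dist_le (N : Set (Euc n)) (x₀ x : Euc n) :
    lipSlope N (fun y => dist y x₀) x ≤ 1 :=
  iInf₂_le (1 : ℝ≥0) ⟨Set.univ, univ_mem, (LipschitzWith.dist_left x₀).lipschitzOnWith⟩

/-- The distance is not smooth at `x₀`, which lies only on the level `r = 0`, a null set of values.
-/
theorem ae_isCountablyRectifiable_dist_level (hk : 1 ≤ k)
    (hint : ∀ x ∈ N ∩ U, IsInteriorPoint k N x) (hfin : μH[(k : ℝ)] (N ∩ U) ≠ ⊤) (x₀ : Euc n) :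
    ∀ᵐ r, IsCountablyRectifiable (k - 1) (N ∩ U ∩ (fun y => dist y x₀) ⁻¹' {r}) := by
  have h1 := ae_isCountablyRectifiable_level (A := (N ∩ U) \ {x₀}) (u := fun y => dist y x₀) hk
    (Set.sdiff_subset.trans Set.inter_subset_left) (fun x hx => hint x hx.1)
    (fun x hx => (contDiffAt_id.dist ℝ contDiffAt_const hx.2).contDiffWithinAt)
    (measure_ne_top_of_subset Set.sdiff_subset hfin)
  filter_upwards [h1, Measure.ae_ne volume (0 : ℝ)] with r hr hr0
  refine hr.mono fun y hy => ⟨⟨hy.1, fun h => hr0 ?_⟩, hy.2⟩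
  have hyr : dist y x₀ = r := hy.2
  rw [← hyr, Set.mem_singleton_iff.1 h, dist_self]

/-- The larger of the distance to `x₀` and the rescaled variation of `f` from `x₀`. -/
noncomputable def variationDist (f : Euc n → ℝ) (D : ℝ) (x₀ y : Euc n) : ℝ :=
  max (dist y x₀) (|f y - f x₀| / D)

theorem lipSlope_variationDist_le {D : ℝ} (hD : 0 < D) {x : Euc n}
    (hf : lipSlope N f x ≤ ENNReal.ofReal D) : lipSlope N (variationDist f D x₀) x ≤ 1 := by
  refine ENNReal.le_of_forall_pos_le_add fun ε hε _ => ?_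
  have h1 : lipSlope N f x < ENNReal.ofReal (D * (1 + ε)) := by
    refine hf.trans_lt ((ENNReal.ofReal_lt_ofReal_iff (by positivity)).2 ?_)
    have : (0 : ℝ) < ε := hε
    nlinarith
  obtain ⟨L, hL, W, hW, hLip⟩ := lipSlope_lt_iff.1 h1
  have hL' : (L : ℝ) ≤ D * (1 + ε) := by
    have := (ENNReal.toReal_mono ENNReal.ofReal_ne_top hL.le)
    rwa [ENNReal.coe_toReal, ENNReal.toReal_ofReal (by positivity)] at this
  refine (iInf₂_le (1 + ε) ⟨W, hW, LipschitzOnWith.of_dist_le_mul fun y hy z hz => ?_⟩).trans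
    (by simp)
  rw [Real.dist_eq]
  have hd : (0 : ℝ) ≤ ε * dist y z := by positivity
  refine (abs_max_sub_max_le_max _ _ _ _).trans (max_le ?_ ?_)
  · refine (abs_dist_sub_le y z x₀).trans ?_
    push_cast
    linarith
  · rw [← sub_div, abs_div, abs_of_pos hD, div_le_iff₀ hD]
    calc |(|f y - f x₀| - |f z - f x₀|)| ≤ |f y - f x₀ - (f z - f x₀)| := abs_abs_sub_abs_le _ _
      _ = dist (f y) (f z) := by rw [sub_sub_sub_cancel_right, Real.dist_eq]
      _ ≤ L * dist y z := hLip.dist_le_mul y hy z hz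
      _ ≤ D * (1 + ε) * dist y z := by gcongr
      _ = _ := by push_cast; ring

/-- The maximum and the absolute value are not smooth, but each level lies in the union of the
`r`-levels of the distance and of `±(f - f x₀) / D`. -/
theorem ae_isCountablyRectifiable_variationDist_level (hk : 1 ≤ k)
    (hint : ∀ x ∈ N ∩ U, IsInteriorPoint k N x) (hfin : μH[(k : ℝ)] (N ∩ U) ≠ ⊤)
    (hf : ∀ x ∈ N ∩ U, ContDiffWithinAt ℝ 1 f N x) (D : ℝ) (x₀ : Euc n) :
    ∀ᵐ r, IsCountablyRectifiable (k - 1) (N ∩ U ∩ variationDist f D x₀ ⁻¹' {r}) := by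
  have h1 := ae_isCountablyRectifiable_level (u := fun y => (f y - f x₀) / D) hk
    Set.inter_subset_left hint (fun x hx => ((hf x hx).sub contDiffWithinAt_const).div_const D) hfin
  have h2 := ae_isCountablyRectifiable_level (u := fun y => (f x₀ - f y) / D) hk
    Set.inter_subset_left hint (fun x hx => (contDiffWithinAt_const.sub (hf x hx)).div_const D) hfin
  filter_upwards [ae_isCountablyRectifiable_dist_level hk hint hfin x₀, h1, h2] with r hr0 hr1 hr2
  refine ((hr0.union hr1).union hr2).mono ?_
  rintro y ⟨hy, hyr⟩
  have hyr' : max (dist y x₀) (|f y - f x₀| / D) = r := hyr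
  rcases max_choice (dist y x₀) (|f y - f x₀| / D) with h | h
  · exact Or.inl (Or.inl ⟨hy, h.symm.trans hyr'⟩)
  · rw [h] at hyr'
    rcases abs_choice (f y - f x₀) with h' | h'
    · exact Or.inl (Or.inr ⟨hy, by rw [h'] at hyr'; exact hyr'⟩)
    · exact Or.inr ⟨hy, by rw [h', neg_sub] at hyr'; exact hyr'⟩

/-- Lower density bound. -/
theorem pow_le_measure_variationDist_lt (hk : 1 ≤ k) (hU : IsOpen U)
    (hint : ∀ x ∈ N ∩ U, IsInteriorPoint k N x) (hfin : μH[(k : ℝ)] (N ∩ U) ≠ ⊤)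
    {D₀ : ℝ} (hD₀ : 0 < D₀) (hiso : IsoperimetricInequality k D₀ N U)
    (hf : ∀ x ∈ N ∩ U, ContDiffWithinAt ℝ 1 f N x)
    {D : ℝ} (hD : 0 < D) (hslope : ∀ x ∈ N ∩ U, lipSlope N f x ≤ ENNReal.ofReal D)
    (hx₀ : x₀ ∈ N ∩ U) (hT : ball x₀ T ⊆ U) {b : ℝ} (hb : 0 < b) (hbT : b < T) :
    (1 / (2 * D₀) / 2 ^ k * (b / 2)) ^ k ≤
      (μH[(k : ℝ)] (N ∩ U ∩ variationDist f D x₀ ⁻¹' Set.Iio b)).toReal := by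
  have hcont : ContinuousOn (variationDist f D x₀) (N ∩ U) := by
    have : ContinuousOn f (N ∩ U) := fun x hx =>
      (hf x hx).continuousWithinAt.mono Set.inter_subset_left
    exact ContinuousOn.sup (continuous_id.dist continuous_const).continuousOn
      ((this.sub continuousOn_const).abs.div_const D)
  have hB : ∃ O, IsOpen O ∧ N ∩ U = O ∩ (N ∩ U) := ⟨Set.univ, isOpen_univ, by simp⟩
  -- The growth argument needs some positive initial mass but no quantitative one: here `B` is all
  -- of `N ∩ U`, so `S = ∅` and `η = 0`.
  have hpos : 0 < (μH[(k : ℝ)] (N ∩ U ∩ variationDist f D x₀ ⁻¹' Set.Iio (b / 2))).toReal := by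
    refine ENNReal.toReal_pos (ne_of_gt ?_) (measure_ne_top_of_subset Set.inter_subset_left hfin)
    have hx₀' : x₀ ∈ N ∩ U ∩ variationDist f D x₀ ⁻¹' Set.Iio (b / 2) :=
      ⟨hx₀, by simp [variationDist, hb]⟩
    obtain ⟨O, hO, hEO⟩ := exists_isOpen_sublevel hcont hB (b / 2)
    rw [hEO] at hx₀' ⊢
    have := (hint x₀ hx₀).hausdorffMeasure_pos (inter_mem (hO.mem_nhds hx₀'.1)
      (hU.mem_nhds hx₀.2))
    rwa [Set.inter_left_comm] at this
  have := pow_le_measure_sublevel hk hU hint hfin hD₀ hiso hcont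
    (fun x hx => lipSlope_variationDist_le hD (hslope x hx)) (fun y => le_max_left _ _) hT
    (ae_isCountablyRectifiable_variationDist_level hk hint hfin hf D x₀) hB (S := ∅)
    (fun y hy => hy.2 hy.1.1) isCountablyRectifiable_empty le_rfl (by simp)
    (half_le_self hb.le) hbT hpos (by
      rw [mul_zero]
      exact Real.rpow_nonneg hpos.le _)
  rwa [sub_half] at this

/-- A band `{s < f < t}` between two level sets of small measure has measure bounded below
independently of its width. -/
theorem pow_le_measure_band (hk : 1 ≤ k) (hU : IsOpen U)
    (hint : ∀ x ∈ N ∩ U, IsInteriorPoint k N x) (hfin : μH[(k : ℝ)] (N ∩ U) ≠ ⊤)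
    {D₀ : ℝ} (hD₀ : 0 < D₀) (hiso : IsoperimetricInequality k D₀ N U)
    (hf : ∀ x ∈ N ∩ U, ContDiffWithinAt ℝ 1 f N x)
    {D : ℝ} (hD : 0 < D) (hslope : ∀ x ∈ N ∩ U, lipSlope N f x ≤ ENNReal.ofReal D)
    (hx₀ : x₀ ∈ N ∩ U) (hT : ball x₀ T ⊆ U) {ρ b : ℝ} (hρ : 0 < ρ) (hρb : ρ ≤ b) (hbT : b < T)
    {s t η : ℝ} (hs : D * ρ ≤ f x₀ - s) (ht : D * ρ ≤ t - f x₀) (hη : 0 ≤ η)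
    (hsrect : IsCountablyRectifiable (k - 1) (N ∩ U ∩ f ⁻¹' {s}))
    (htrect : IsCountablyRectifiable (k - 1) (N ∩ U ∩ f ⁻¹' {t}))
    (hsη : μH[((k - 1 : ℕ) : ℝ)] (N ∩ U ∩ f ⁻¹' {s}) ≤ ENNReal.ofReal η)
    (htη : μH[((k - 1 : ℕ) : ℝ)] (N ∩ U ∩ f ⁻¹' {t}) ≤ ENNReal.ofReal η)
    (hηρ : 2 * D₀ * (η + η) ≤ ((1 / (2 * D₀) / 2 ^ k * (ρ / 2)) ^ k) ^ (((k : ℝ) - 1) / k)) :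
    (1 / (2 * D₀) / 2 ^ k * (b - ρ)) ^ k ≤
      (μH[(k : ℝ)] (N ∩ U ∩ f ⁻¹' Set.Ioo s t)).toReal := by
  have hfc : ContinuousOn f (N ∩ U) := fun x hx =>
    (hf x hx).continuousWithinAt.mono Set.inter_subset_left
  have hB : ∃ O, IsOpen O ∧ N ∩ U ∩ f ⁻¹' Set.Ioo s t = O ∩ (N ∩ U) := by
    obtain ⟨O, hO, h⟩ := (_root_.continuousOn_iff'.1 hfc) (Set.Ioo s t) isOpen_Ioo
    exact ⟨O, hO, by rw [Set.inter_comm, h]⟩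
  have hS : (N ∩ U ∩ closure (N ∩ U ∩ f ⁻¹' Set.Ioo s t)) \ (N ∩ U ∩ f ⁻¹' Set.Ioo s t) ⊆
      N ∩ U ∩ f ⁻¹' {s} ∪ N ∩ U ∩ f ⁻¹' {t} := by
    rintro y ⟨⟨hyM, hyc⟩, hy⟩
    have h1 : f y ∈ Set.Icc s t := by
      refine closure_minimal ?_ isClosed_Icc
        (((hfc y hyM).mono Set.inter_subset_left).mem_closure_image hyc)
      rintro _ ⟨z, hz, rfl⟩
      exact Set.Ioo_subset_Icc_self hz.2
    rcases h1.1.eq_or_lt with h | h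
    · exact Or.inl ⟨hyM, h.symm⟩
    rcases h1.2.eq_or_lt with h' | h'
    · exact Or.inr ⟨hyM, h'⟩
    · exact absurd ⟨hyM, h, h'⟩ hy
  have hfin' : ∀ r, μH[(k : ℝ)] (N ∩ U ∩ f ⁻¹' Set.Ioo s t ∩
      (fun y => dist y x₀) ⁻¹' Set.Iio r) ≠ ⊤ := fun r =>
    measure_ne_top_of_subset (Set.inter_subset_left.trans Set.inter_subset_left) hfin
  have hV := pow_le_measure_variationDist_lt hk hU hint hfin hD₀ hiso hf hD hslope hx₀ hT hρ
    (hρb.trans_lt hbT)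
  -- Since `s` and `t` are at least `D ρ` away from `f x₀`, the set `variationDist < ρ` lies in both
  -- the band and the ball.
  have hV' : (1 / (2 * D₀) / 2 ^ k * (ρ / 2)) ^ k ≤ (μH[(k : ℝ)] (N ∩ U ∩ f ⁻¹' Set.Ioo s t ∩
      (fun y => dist y x₀) ⁻¹' Set.Iio ρ)).toReal := by
    refine hV.trans (ENNReal.toReal_mono (hfin' ρ) (measure_mono ?_))
    rintro y ⟨hyM, hy⟩
    have hyρ : max (dist y x₀) (|f y - f x₀| / D) < ρ := hy
    obtain ⟨h1, h2⟩ := max_lt_iff.1 hyρ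
    rw [div_lt_iff₀ hD, abs_lt] at h2
    exact ⟨⟨hyM, by linarith, by linarith⟩, h1⟩
  have hpos : 0 < (1 / (2 * D₀) / 2 ^ k * (ρ / 2)) ^ k := by positivity
  have hp0 : 0 ≤ ((k : ℝ) - 1) / k :=
    div_nonneg (sub_nonneg.2 (by exact_mod_cast hk)) (Nat.cast_nonneg k)
  -- From radius `ρ` on, the growth uses the plain distance, so the mass gained no longer depends on
  -- the width of the band.
  refine (pow_le_measure_sublevel hk hU hint hfin hD₀ hiso
    (continuous_id.dist continuous_const).continuousOn (fun x _ => lipSlope_dist_le N x₀ x)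
    (fun y => le_rfl) hT (ae_isCountablyRectifiable_dist_level hk hint hfin x₀) hB hS
    (hsrect.union htrect) (add_nonneg hη hη) ?_ hρb hbT (hpos.trans_le hV')
    (hηρ.trans (Real.rpow_le_rpow hpos.le hV' hp0))).trans
      (ENNReal.toReal_mono (measure_ne_top_of_subset Set.inter_subset_left hfin)
        (measure_mono Set.inter_subset_left))
  rw [ENNReal.ofReal_add hη hη]
  exact (measure_union_le _ _).trans (add_le_add hsη htη)

/-- Every interval contains a value whose level set is rectifiable and has small measure. -/
theorem exists_level_small (hk : 1 ≤ k)
    (hint : ∀ x ∈ N ∩ U, IsInteriorPoint k N x) (hfin : μH[(k : ℝ)] (N ∩ U) ≠ ⊤)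
    (hf : ∀ x ∈ N ∩ U, ContDiffWithinAt ℝ 1 f N x) {η l : ℝ} (hl : 0 < l)
    (hsmall : ∫⁻ x in N ∩ U, lipSlope N f x ∂μH[(k : ℝ)] ≤ ENNReal.ofReal (η * l)) (c : ℝ) :
    ∃ s ∈ Set.Ioo c (c + l), IsCountablyRectifiable (k - 1) (N ∩ U ∩ f ⁻¹' {s}) ∧
      μH[((k - 1 : ℕ) : ℝ)] (N ∩ U ∩ f ⁻¹' {s}) ≤ ENNReal.ofReal η := by
  obtain ⟨g, hgm, hg, hgi⟩ := exists_measurable_level_bound_nat hk Set.inter_subset_left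
    (fun x hx => (hint x hx).lipSlope_lt_top (hf x hx)) hfin
  have hvol : volume (Set.Ioo c (c + l)) = ENNReal.ofReal l := by simp
  have hl0 : ENNReal.ofReal l ≠ 0 := (ENNReal.ofReal_pos.2 hl).ne'
  have hae : ∀ᵐ s ∂(volume.restrict (Set.Ioo c (c + l))), s ∈ Set.Ioo c (c + l) ∧
      IsCountablyRectifiable (k - 1) (N ∩ U ∩ f ⁻¹' {s}) :=
    (ae_restrict_mem measurableSet_Ioo).and
      (ae_restrict_of_ae (ae_isCountablyRectifiable_level hk Set.inter_subset_left hint hf hfin))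
  -- Outside the null set of bad values some level is at most the average of `g`, which is at most
  -- `η l / l`.
  obtain ⟨s, hs, hgs⟩ := exists_notMem_null_le_laverage
    (μ := volume.restrict (Set.Ioo c (c + l)))
    (by rw [ne_eq, Measure.restrict_eq_zero, hvol]; exact hl0) hgm.aemeasurable hae
  simp only [Set.mem_compl_iff, Set.mem_ofPred_eq, not_not] at hs
  refine ⟨s, hs.1, hs.2, (hg s).trans (hgs.trans ?_)⟩
  rw [setLAverage_eq, hvol]
  refine ENNReal.div_le_of_le_mul ?_
  rw [← ENNReal.ofReal_mul' hl.le]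
  exact (setLIntegral_le_lintegral _ _).trans (hgi.trans hsmall)

/-- `y` and `z` lie in the same component of `S`, where the intermediate value theorem applies; the
point found may lie outside `B`. -/
theorem exists_eq_of_componentsMeeting_subsingleton {S B : Set (Euc n)}
    (hconn : (componentsMeeting S B).Subsingleton) (hf : ContinuousOn f S) {y z : Euc n}
    (hyS : y ∈ S) (hyB : y ∈ B) (hzS : z ∈ S) (hzB : z ∈ B) {c : ℝ}
    (hc : c ∈ Set.Icc (f y) (f z)) : ∃ x ∈ S, f x = c := by
  have hy := mem_connectedComponentIn hyS
  have hz := mem_connectedComponentIn hzS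
  have h : connectedComponentIn S y = connectedComponentIn S z :=
    hconn ⟨⟨y, hyS, rfl⟩, y, hy, hyB⟩ ⟨⟨z, hzS, rfl⟩, z, hz, hzB⟩
  rw [← h] at hz
  have hsub := connectedComponentIn_subset S y
  obtain ⟨x, hx, hxc⟩ := isPreconnected_connectedComponentIn.intermediate_value hy hz
    (hf.mono hsub) hc
  exact ⟨x, hsub hx, hxc⟩

/-- If the integral of the local Lipschitz constant of `f` is small, then so is the oscillation
of `f` on the smaller ball. -/
theorem exists_forall_sub_le (n : ℕ) (hk : 1 ≤ k) {R D₀ D ε : ℝ} (hR : 0 < R) (hD₀ : 0 < D₀)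
    (hD : 0 < D) (hε : 0 < ε) :
    ∃ δ : ℝ, 0 < δ ∧ ∀ (N : Set (Euc n)) (f : Euc n → ℝ),
      (∀ x ∈ N ∩ ball 0 (3 * R), IsInteriorPoint k N x) →
      μH[(k : ℝ)] (N ∩ ball 0 (3 * R)) ≤ ENNReal.ofReal (D₀ * R ^ k) →
      IsoperimetricInequality k D₀ N (ball 0 (3 * R)) →
      (∀ x ∈ N ∩ ball 0 (3 * R), ContDiffWithinAt ℝ 1 f N x) →
      (∀ x ∈ N ∩ ball 0 (3 * R), lipSlope N f x ≤ ENNReal.ofReal D) →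
      (componentsMeeting (N ∩ ball 0 (2 * R)) (ball 0 R)).Subsingleton →
      ∫⁻ x in N ∩ ball 0 (3 * R), lipSlope N f x ∂μH[(k : ℝ)] ≤ ENNReal.ofReal δ →
      ∀ y ∈ N ∩ ball 0 R, ∀ z ∈ N ∩ ball 0 R, f z - f y ≤ ε := by
  -- `v` is the mass every band gains between radii `R / 4` and `R / 2`; `m` is then taken so large
  -- that `m` disjoint bands exceed the area bound.
  set v : ℝ := (1 / (2 * D₀) / 2 ^ k * (R / 2 - R / 4)) ^ k with hv
  have hv0 : 0 < v := by
    have : 0 < R / 2 - R / 4 := by linarith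
    positivity
  obtain ⟨m, hm⟩ := exists_nat_gt (D₀ * R ^ k / v)
  have hm0 : (0 : ℝ) < m := (by positivity : (0 : ℝ) ≤ D₀ * R ^ k / v).trans_lt hm
  rw [div_lt_iff₀ hv0] at hm
  set w : ℝ := ε / m with hw
  have hw0 : 0 < w := by positivity
  have hmw : m * w = ε := mul_div_cancel₀ _ hm0.ne'
  -- The selected levels are at least `w / 4` from the middle value, which requires `D ρ ≤ w / 4`;
  -- `ρ ≤ R / 4` leaves room for the growth.
  set ρ : ℝ := min (R / 4) (w / 4 / D) with hρ
  have hρ0 : 0 < ρ := by positivity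
  have hρw : D * ρ ≤ w / 4 := by
    rw [mul_comm, ← le_div_iff₀ hD]
    exact min_le_right _ _
  have hρR : ρ ≤ R / 4 := min_le_left _ _
  set c : ℝ := ((1 / (2 * D₀) / 2 ^ k * (ρ / 2)) ^ k) ^ (((k : ℝ) - 1) / k) with hc
  have hc0 : 0 < c := Real.rpow_pos_of_pos (by positivity) _
  set η : ℝ := c / (4 * D₀) with hη
  have hη0 : 0 < η := by positivity
  have hηc : 2 * D₀ * (η + η) ≤ c := by
    have : 4 * D₀ * η = c := mul_div_cancel₀ _ (by positivity)
    linarith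
  refine ⟨η * (w / 4), by positivity, fun N f hint harea hiso hf hslope hconn hsmall y hy z hz => ?_⟩
  by_contra! hlt
  have hfin : μH[(k : ℝ)] (N ∩ ball 0 (3 * R)) ≠ ⊤ := ne_top_of_le_ne_top ENNReal.ofReal_ne_top harea
  have hfc : ContinuousOn f (N ∩ ball 0 (3 * R)) := fun x hx =>
    (hf x hx).continuousWithinAt.mono Set.inter_subset_left
  have h23 : N ∩ ball 0 (2 * R) ⊆ N ∩ ball (0 : Euc n) (3 * R) :=
    Set.inter_subset_inter_right _ (ball_subset_ball (by linarith))
  have h12 : N ∩ ball 0 R ⊆ N ∩ ball (0 : Euc n) (2 * R) :=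
    Set.inter_subset_inter_right _ (ball_subset_ball (by linarith))
  have hband : ∀ j ∈ Finset.range m, ∃ s t, f y + j * w < s ∧ t < f y + (j + 1) * w ∧
      v ≤ (μH[(k : ℝ)] (N ∩ ball 0 (3 * R) ∩ f ⁻¹' Set.Ioo s t)).toReal := by
    intro j hj
    have hjm : ((j + 1 : ℕ) : ℝ) ≤ m := by exact_mod_cast Finset.mem_range.1 hj
    have hjw : ((j + 1 : ℕ) : ℝ) * w ≤ m * w := by gcongr
    have hj0 : (0 : ℝ) ≤ j * w := by positivity
    push_cast at hjw
    -- `s` is taken in the first quarter of the interval, `t` in the last, and `x` at the middle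
    -- value. As `x ∈ B_{2R}`, the ball of radius `R` about it stays in `B_{3R}`.
    obtain ⟨s, hs, hsr, hsη⟩ := exists_level_small hk hint hfin hf (by positivity : 0 < w / 4)
      hsmall (f y + j * w)
    obtain ⟨t, ht, htr, htη⟩ := exists_level_small hk hint hfin hf (by positivity : 0 < w / 4)
      hsmall (f y + j * w + 3 * (w / 4))
    obtain ⟨x, hx, hfx⟩ := exists_eq_of_componentsMeeting_subsingleton hconn (hfc.mono h23)
      (h12 hy) hy.2 (h12 hz) hz.2 (c := f y + j * w + w / 2) ⟨by linarith, by linarith⟩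
    refine ⟨s, t, hs.1, by linarith [ht.2], ?_⟩
    have hT : ball x R ⊆ ball 0 (3 * R) := ball_subset_ball' (by linarith [mem_ball.1 hx.2])
    have hb := pow_le_measure_band hk isOpen_ball hint hfin hD₀ hiso hf hD hslope (h23 hx) hT hρ0
      (b := R / 2) (by linarith) (by linarith) (s := s) (t := t)
      (by rw [hfx]; linarith [hs.2]) (by rw [hfx]; linarith [ht.1]) hη0.le hsr htr hsη htη hηc
    refine le_trans ?_ hb
    have : 0 ≤ R / 2 - R / 4 := by linarith
    rw [hv]
    gcongr
  choose! s t hs ht hst using hband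
  set B : ℕ → Set (Euc n) := fun j => N ∩ ball 0 (3 * R) ∩ f ⁻¹' Set.Ioo (s j) (t j) with hB
  have hBm : ∀ j, MeasurableSet (B j) := fun j => by
    obtain ⟨O, hO, h⟩ := (_root_.continuousOn_iff'.1 hfc) (Set.Ioo (s j) (t j)) isOpen_Ioo
    simp only [hB]
    rw [Set.inter_comm, h]
    exact hO.measurableSet.inter (measurableSet_of_forall_isInteriorPoint isOpen_ball hint)
  have hdisj : ∀ i ∈ Finset.range m, ∀ j ∈ Finset.range m, i < j → Disjoint (B i) (B j) := by
    intro i hi j hj hij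
    refine Set.disjoint_left.2 fun p hpi hpj => ?_
    have h1 : f p < t i := hpi.2.2
    have h2 : s j < f p := hpj.2.1
    have h3 : (((i + 1 : ℕ) : ℝ)) * w ≤ j * w := by
      gcongr
      exact_mod_cast hij
    push_cast at h3
    linarith [hs j hj, ht i hi]
  have hpair : (Finset.range m : Set ℕ).PairwiseDisjoint B := by
    intro i hi j hj hij
    rcases hij.lt_or_gt with h | h
    · exact hdisj i hi j hj h
    · exact (hdisj j hj i hi h).symm
  have hsum : ∑ j ∈ Finset.range m, (μH[(k : ℝ)] (B j)).toReal ≤ D₀ * R ^ k := by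
    rw [← ENNReal.toReal_sum fun j _ => measure_ne_top_of_subset Set.inter_subset_left hfin,
      ← measure_biUnion_finset hpair fun j _ => hBm j]
    refine ENNReal.toReal_le_of_le_ofReal (by positivity) ((measure_mono ?_).trans harea)
    exact Set.iUnion₂_subset fun j _ => Set.inter_subset_left
  have hge : m * v ≤ ∑ j ∈ Finset.range m, (μH[(k : ℝ)] (B j)).toReal := by
    have := Finset.card_nsmul_le_sum (Finset.range m) _ v hst
    rwa [Finset.card_range, nsmul_eq_mul] at this
  linarith

end Bands

/-! ### Passage to the limit and the main theorem. -/

/-- The integral of a function tends to zero if the integral of its square does, on sets of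
bounded measure. -/
theorem tendsto_lintegral_of_tendsto_lintegral_sq {X : Type*} [MeasurableSpace X]
    (μ : ℕ → Measure X) {C : ℝ≥0∞} (hC : C ≠ ⊤) (hμ : ∀ i, μ i Set.univ ≤ C)
    {f : ℕ → X → ℝ≥0∞} (hf : ∀ i, Measurable (f i))
    (h : Tendsto (fun i => ∫⁻ x, f i x ^ 2 ∂μ i) atTop (𝓝 0)) :
    Tendsto (fun i => ∫⁻ x, f i x ∂μ i) atTop (𝓝 0) := by
  have hle : ∀ i, ∫⁻ x, f i x ∂μ i ≤
      (∫⁻ x, f i x ^ 2 ∂μ i) ^ (1 / 2 : ℝ) * C ^ (1 / 2 : ℝ) := fun i => by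
    have h2 : Real.HolderConjugate 2 2 := Real.HolderConjugate.two_two
    have := ENNReal.lintegral_mul_le_Lp_mul_Lq (μ i) h2 (hf i).aemeasurable
      (aemeasurable_const (b := (1 : ℝ≥0∞)))
    simp only [Pi.mul_apply, mul_one, ENNReal.rpow_two, one_pow, lintegral_one] at this
    exact this.trans (by gcongr; exact hμ i)
  have hlim : Tendsto (fun i => (∫⁻ x, f i x ^ 2 ∂μ i) ^ (1 / 2 : ℝ) * C ^ (1 / 2 : ℝ)) atTop
      (𝓝 0) := by
    have h1 := (h.ennrpow_const (1 / 2 : ℝ))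
    rw [ENNReal.zero_rpow_of_pos (by norm_num)] at h1
    have h2 := ENNReal.Tendsto.mul_const (b := C ^ (1 / 2 : ℝ)) h1
      (Or.inr (ENNReal.rpow_ne_top_of_nonneg (by norm_num) hC))
    rwa [zero_mul] at h2
  exact tendsto_of_tendsto_of_tendsto_of_le_of_le tendsto_const_nhds hlim (fun _ => bot_le) hle

/-- Functions that are uniformly bounded and whose oscillations tend to zero converge uniformly,
along a subsequence, to a constant. -/
theorem exists_subseq_tendsto_const {X : Type*} {S : ℕ → Set X} {f : ℕ → X → ℝ} {C : ℝ}
    (hbdd : ∀ i, ∀ x ∈ S i, |f i x| ≤ C)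
    (hosc : ∀ ε : ℝ, 0 < ε → ∀ᶠ i in atTop, ∀ y ∈ S i, ∀ z ∈ S i, f i z - f i y ≤ ε) :
    ∃ (a : ℝ) (φ : ℕ → ℕ), StrictMono φ ∧
      Tendsto (fun j => ⨆ x ∈ S (φ j), ‖f (φ j) x - a‖ₑ) atTop (𝓝 0) := by
  -- One value of `f i` represents the whole function; if `S i` is empty, `0` is used, and `|C|`
  -- keeps it in the interval whatever the sign of `C`.
  have hc : ∀ i, ∃ c ∈ Set.Icc (-|C|) |C|, ∀ x ∈ S i, ∃ y ∈ S i, f i y = c := by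
    intro i
    rcases (S i).eq_empty_or_nonempty with h | ⟨y, hy⟩
    · exact ⟨0, by simp, by simp [h]⟩
    · exact ⟨f i y, abs_le.1 ((hbdd i y hy).trans (le_abs_self C)), fun _ _ => ⟨y, hy, rfl⟩⟩
  choose c hc hcS using hc
  obtain ⟨a, -, φ, hφ, hlim⟩ := isCompact_Icc.tendsto_subseq hc
  refine ⟨a, φ, hφ, ENNReal.tendsto_nhds_zero.2 fun ε hε => ?_⟩
  obtain ⟨e, he0, heε⟩ : ∃ e : ℝ, 0 < e ∧ ENNReal.ofReal e ≤ ε := by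
    obtain ⟨e, he, heε⟩ := ENNReal.lt_iff_exists_nnreal_btwn.1 hε
    exact ⟨e, by exact_mod_cast he, by simpa using heε.le⟩
  filter_upwards [hφ.tendsto_atTop.eventually (hosc (e / 2) (half_pos he0)),
    Metric.tendsto_nhds.1 hlim (e / 2) (half_pos he0)] with j h1 h2
  refine iSup₂_le fun x hx => le_trans ?_ heε
  obtain ⟨y, hy, hyc⟩ := hcS (φ j) x hx
  rw [← ofReal_norm]
  refine ENNReal.ofReal_le_ofReal ?_
  have h3 := h1 x hx y hy
  have h4 := h1 y hy x hx
  rw [Function.comp_apply, Real.dist_eq, abs_lt] at h2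
  rw [Real.norm_eq_abs, abs_le]
  constructor <;> linarith

end PoincareLemma

theorem mainTheorem6 (n k : ℕ) (hk : 1 ≤ k) (R : ℝ) (hR : 0 < R)
    (N : ℕ → Set (PoincareLemma.Euc n)) (α : ℕ → PoincareLemma.Euc n → ℝ)
    (hN : ∀ i, PoincareLemma.IsSmoothSubmanifold k (N i))
    (hα : ∀ i, ContDiffOn ℝ ∞ (α i) (N i))
    (D₀ D₁ : ℝ)
    (hArea : ∀ i, μH[(k : ℝ)] (N i ∩ ball 0 (3 * R)) ≤ ENNReal.ofReal (D₀ * R ^ k))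
    (hIso : ∀ i, PoincareLemma.IsoperimetricInequality k D₀ (N i) (ball 0 (3 * R)))
    (hC1 : ∀ i,
      (⨆ x ∈ N i ∩ ball 0 (3 * R), ‖PoincareLemma.tangentialGradient (N i) (α i) x‖ₑ) +
        ENNReal.ofReal R⁻¹ * (⨆ x ∈ N i ∩ ball 0 (3 * R), ‖α i x‖ₑ) ≤ ENNReal.ofReal D₁)
    (hGrad : Tendsto
      (fun i => ∫⁻ x in N i ∩ ball 0 (3 * R),
        ‖PoincareLemma.tangentialGradient (N i) (α i) x‖ₑ ^ 2 ∂μH[(k : ℝ)])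
      atTop (𝓝 0))
    (hBdry : ∀ i, PoincareLemma.manifoldBoundary k (N i) ∩ ball 0 (3 * R) = ∅)
    (hConn : ∀ i,
      (PoincareLemma.componentsMeeting (N i ∩ ball 0 (2 * R)) (ball 0 R)).Subsingleton) :
    ∃ (a : ℝ) (φ : ℕ → ℕ), StrictMono φ ∧
      Tendsto (fun j => ⨆ x ∈ N (φ j) ∩ ball 0 R, ‖α (φ j) x - a‖ₑ) atTop (𝓝 0) := by
  have hint : ∀ i, ∀ x ∈ N i ∩ ball 0 (3 * R), PoincareLemma.IsInteriorPoint k (N i) x :=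
    fun i x hx => (hN i x hx.1).resolve_right fun h => by
      have : x ∈ PoincareLemma.manifoldBoundary k (N i) ∩ ball 0 (3 * R) := ⟨h, hx.2⟩
      rwa [hBdry i] at this
  have hsm : ∀ i, ∀ x ∈ N i ∩ ball 0 (3 * R), ContDiffWithinAt ℝ 1 (α i) (N i) x :=
    fun i x hx => (hα i x hx.1).of_le (by simp)
  have hslope : ∀ i, ∀ x ∈ N i ∩ ball 0 (3 * R), PoincareLemma.lipSlope (N i) (α i) x ≤
      ‖PoincareLemma.tangentialGradient (N i) (α i) x‖ₑ :=
    fun i x hx => (hint i x hx).lipSlope_le_gradient (hsm i x hx)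
  -- `D₀` and `D₁` are not assumed positive, so each is replaced by its maximum with `1`.
  have hslopeD : ∀ i, ∀ x ∈ N i ∩ ball 0 (3 * R), PoincareLemma.lipSlope (N i) (α i) x ≤
      ENNReal.ofReal (max D₁ 1) := fun i x hx =>
    (hslope i x hx).trans <|
      (le_iSup₂ (f := fun x _ => ‖PoincareLemma.tangentialGradient (N i) (α i) x‖ₑ) x hx).trans <|
        (le_self_add.trans (hC1 i)).trans (ENNReal.ofReal_le_ofReal (le_max_left _ _))
  have hbdd : ∀ i, ∀ x ∈ N i ∩ ball 0 R, |α i x| ≤ max D₁ 1 * R := fun i x hx => by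
    have hx3 : x ∈ N i ∩ ball 0 (3 * R) := ⟨hx.1, ball_subset_ball (by linarith) hx.2⟩
    have h1 : ENNReal.ofReal R⁻¹ * ‖α i x‖ₑ ≤ ENNReal.ofReal (max D₁ 1) :=
      (mul_le_mul_right (le_iSup₂ (f := fun x _ => ‖α i x‖ₑ) x hx3) _).trans
        ((le_add_self.trans (hC1 i)).trans (ENNReal.ofReal_le_ofReal (le_max_left _ _)))
    rw [← ofReal_norm, ← ENNReal.ofReal_mul (by positivity),
      ENNReal.ofReal_le_ofReal_iff (by positivity), inv_mul_le_iff₀ hR, mul_comm] at h1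
    exact h1
  have harea : ∀ i, μH[(k : ℝ)] (N i ∩ ball 0 (3 * R)) ≤ ENNReal.ofReal (max D₀ 1 * R ^ k) :=
    fun i => (hArea i).trans (ENNReal.ofReal_le_ofReal (by gcongr; exact le_max_left _ _))
  have hiso : ∀ i, PoincareLemma.IsoperimetricInequality k (max D₀ 1) (N i) (ball 0 (3 * R)) :=
    fun i A hA hAN hAO hAr => (hIso i A hA hAN hAO hAr).trans
      (by gcongr; exact le_max_left _ _)
  have hmeas : ∀ i, MeasurableSet (N i ∩ ball 0 (3 * R)) := fun i =>
    PoincareLemma.measurableSet_of_forall_isInteriorPoint isOpen_ball (hint i)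
  have hlim : Tendsto (fun i => ∫⁻ x in N i ∩ ball 0 (3 * R),
      PoincareLemma.lipSlope (N i) (α i) x ∂μH[(k : ℝ)]) atTop (𝓝 0) := by
    -- Cauchy–Schwarz is applied to the measurable `lipSlope`; the gradient enters only as an upper
    -- bound, so its measurability is not needed.
    refine PoincareLemma.tendsto_lintegral_of_tendsto_lintegral_sq
      (fun i => μH[(k : ℝ)].restrict (N i ∩ ball 0 (3 * R))) ENNReal.ofReal_ne_top
      (fun i => by rw [Measure.restrict_apply_univ]; exact harea i)
      (fun i => PoincareLemma.measurable_lipSlope _ _) ?_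
    refine tendsto_of_tendsto_of_tendsto_of_le_of_le tendsto_const_nhds hGrad
      (fun _ => bot_le) fun i => lintegral_mono_ae ?_
    exact ae_restrict_of_forall_mem (hmeas i) fun x hx => by
      gcongr
      exact hslope i x hx
  refine PoincareLemma.exists_subseq_tendsto_const (S := fun i => N i ∩ ball 0 R) (f := α) hbdd
    fun ε hε => ?_
  obtain ⟨δ, hδ, h⟩ := PoincareLemma.exists_forall_sub_le n hk hR
    (lt_max_of_lt_right one_pos : (0 : ℝ) < max D₀ 1)
    (lt_max_of_lt_right one_pos : (0 : ℝ) < max D₁ 1) hε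
  filter_upwards [ENNReal.tendsto_nhds_zero.1 hlim _ (ENNReal.ofReal_pos.2 hδ)] with i hi
  exact h (N i) (α i) (hint i) (harea i) (hiso i) (hsm i) (hslopeD i) (hConn i) hi
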